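/- Let $n\ge 1$ and let $M$ be a smooth (Hausdorff, second countable) manifold of dimension $2n+1$. An almost paracontact paracomplex Riemannian structure on $M$ consists of a smooth $(1,1)$-tensor field $\phi$, a smooth vector field $\xi$, a smooth $1$-form $\eta$ and a Riemannian metric $g$ such that $\phi^2=\mathrm{id}-\eta\otimes\xi$, $\eta(\xi)=1$, $g(x,\xi)=\eta(x)$, $g(\phi x,\phi y)=g(x,y)-\eta(x)\eta(y)$, and the eigenspaces of $\phi$ on $H=\ker\eta$ for the eigenvalues $1$ and $-1$ both have dimension $n$. Let $\nabla$ be the Levi-Civita connection of $g$ and $F(x,y,z)=g((\nabla_x\phi)y,z)$. The structure is called para-Sasaki-like if, for all horizontal vector fields $X,Y,Z$ (smooth sections of $H$), $$F(X,Y,Z)=F(\xi,Y,Z)=F(\xi,\xi,Z)=0,\qquad F(X,Y,\xi)=-g(X,Y).$$ For smooth functions $u,v,w$ on $M$, the paracontact conformal transformation of $(\phi,\xi,\eta,g)$ is the structure $(\phi,\overline\xi,\overline\eta,\overline g)$ of the same kind given by $\overline\eta=e^{w}\eta$, $\overline\xi=e^{-w}\xi$ and $$\overline g(x,y)=e^{2u}\cosh(2v)\,g(x,y)+e^{2u}\sinh(2v)\,g(x,\phi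 y)+\{e^{2w}-e^{2u}\cosh(2v)\}\,\eta(x)\eta(y).$$ **Proposition.** Let $(\phi,\xi,\eta,g)$ be para-Sasaki-like and let $u,v,w$ be smooth functions on $M$. 1. The structure $(\phi,\overline\xi,\overline\eta,\overline g)$ is para-Sasaki-like if and only if $$dw\circ\phi=0,\qquad du-dv\circ\phi=0,\qquad du\circ\phi-dv=(1-e^{w})\,\eta .$$ 2. In that case $du(\xi)=0$ and $dv(\xi)=e^{w}-1$. 3. Suppose that $w=0$. An integral submanifold of $H$ is a smooth (Hausdorff, second countable) $2n$-dimensional manifold $N$ with a smooth immersion into $M$ whose tangent spaces are $TN=H$; let $P$ be the restriction of $\phi$ to $TN$. A paracomplex-valued function $f=a+e\,b$ on $N$ (with $e^2=1$ and $a,b$ real) is called paraholomorphic if $a$ and $b$ are smooth and $df\circ P=e\,df$. * The structure $(\phi,\overline\xi,\overline\eta,\overline g)$ is para-Sasaki-like if and only if $du(\xi)=dv(\xi)=0$ and, for every integral submanifold $N$ of $H$, the restriction of $u+e\,v$ to $N$ is paraholomorphic. * If it is para-Sasaki-like, then $u$ and $v$ are locally defined on $N$: for every local splitting of $M$ as a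 product of an open interval and a $2n$-manifold $N$ with an endomorphism field $P$ of $TN$ (a smooth map $\Phi:(a,b)\times N\to M$, $a<b$, with $\partial\Phi/\partial t=\xi$, such that every slice $\Phi(t,\cdot)$ is an integral submanifold of $H$ on which $\phi$ restricts to $P$), there are functions $u_N,v_N$ on $N$ with $u(\Phi(t,x))=u_N(x)$ and $v(\Phi(t,x))=v_N(x)$ for all $t\in(a,b)$ and $x\in N$, and $u_N+e\,v_N$ is paraholomorphic on $N$. -/

import Mathlib

open Bundle FiberBundle Set Module
open scoped Manifold ContDiff

noncomputable section

namespace ParacontactGeometry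

section General

variable {E : Type*} [NormedAddCommGroup E] [NormedSpace ℝ E] [FiniteDimensional ℝ E]
  {H : Type*} [TopologicalSpace H] {I : ModelWithCorners ℝ E H}
  {M : Type*} [TopologicalSpace M] [ChartedSpace H M] [IsManifold I ∞ M]

/-- Smooth Riemannian metrics on the manifold `M`. -/
abbrev RiemMetric (I : ModelWithCorners ℝ E H) (M : Type*) [TopologicalSpace M]
    [ChartedSpace H M] [IsManifold I ∞ M] :=
  ContMDiffRiemannianMetric I ∞ E (fun p : M => TangentSpace I p)

/-- `X` is a smooth vector field on `M`. -/
def IsSmoothField (I : ModelWithCorners ℝ E H) {M : Type*} [TopologicalSpace M]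
    [ChartedSpace H M] [IsManifold I ∞ M] (X : ∀ p : M, TangentSpace I p) : Prop :=
  ContMDiff I I.tangent ∞ (fun p => (⟨p, X p⟩ : TangentBundle I M))

/-! ### The Levi-Civita connection -/

/-- The right hand side of the Koszul formula, divided by two: the value of `g(∇_X Y, Z)` at `p`. -/
def koszul (g : RiemMetric I M) (X Y Z : ∀ p : M, TangentSpace I p) (p : M) : ℝ :=
  (1 / 2 : ℝ) *
    (mvfderiv I (fun q => g.inner q (Y q) (Z q)) p (X p)
      + mvfderiv I (fun q => g.inner q (Z q) (X q)) p (Y p)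
      - mvfderiv I (fun q => g.inner q (X q) (Y q)) p (Z p)
      + g.inner p (VectorField.mlieBracket I X Y p) (Z p)
      + g.inner p (VectorField.mlieBracket I Z X p) (Y p)
      + g.inner p (VectorField.mlieBracket I Z Y p) (X p))


theorem mdifferentiableAt_inner (g : RiemMetric I M) {X Y : ∀ p : M, TangentSpace I p} {p : M}
    (hX : MDifferentiableAt I I.tangent (fun q => (⟨q, X q⟩ : TangentBundle I M)) p)
    (hY : MDifferentiableAt I I.tangent (fun q => (⟨q, Y q⟩ : TangentBundle I M)) p) :
    MDifferentiableAt I 𝓘(ℝ, ℝ) (fun q => g.inner q (X q) (Y q)) p := by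
  have h : MDifferentiableAt I (I.prod 𝓘(ℝ, ℝ))
      (fun m ↦ TotalSpace.mk' ℝ (E := Bundle.Trivial M ℝ) m (g.inner m (X m) (Y m))) p := by
    apply MDifferentiableAt.clm_bundle_apply₂ (F₁ := E) (F₂ := E)
    · exact (g.contMDiff.mdifferentiable (by simp)) p
    · exact hX
    · exact hY
  simp only [mdifferentiableAt_totalSpace] at h
  exact h.2

theorem koszul_tensorial (g : RiemMetric I M) {X Y : ∀ p : M, TangentSpace I p} {p : M}
    (hX : MDifferentiableAt I I.tangent (fun q => (⟨q, X q⟩ : TangentBundle I M)) p)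
    (hY : MDifferentiableAt I I.tangent (fun q => (⟨q, Y q⟩ : TangentBundle I M)) p) :
    TensorialAt I E (fun Z => koszul g X Y Z p) p where
  smul {f Z} hf hZ := by
    have h1 := mdifferentiableAt_inner g hY hZ
    have h2 := mdifferentiableAt_inner g hZ hX
    have e1 : (fun q => g.inner q (Y q) ((f • Z) q)) = fun q => f q * g.inner q (Y q) (Z q) := by
      ext q; simp
    have e2 : (fun q => g.inner q ((f • Z) q) (X q)) = fun q => f q * g.inner q (Z q) (X q) := by
      ext q; simp
    simp only [koszul, e1, e2, mvfderiv_fun_mul hf h1, mvfderiv_fun_mul hf h2,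
      VectorField.mlieBracket_smul_left hf hZ]
    simp [g.symm p (Z p)]
    ring
  add {Z Z'} hZ hZ' := by
    have h1 := mdifferentiableAt_inner g hY hZ
    have h2 := mdifferentiableAt_inner g hZ hX
    have h1' := mdifferentiableAt_inner g hY hZ'
    have h2' := mdifferentiableAt_inner g hZ' hX
    have e1 : (fun q => g.inner q (Y q) ((Z + Z') q))
        = fun q => g.inner q (Y q) (Z q) + g.inner q (Y q) (Z' q) := by
      ext q; simp
    have e2 : (fun q => g.inner q ((Z + Z') q) (X q))
        = fun q => g.inner q (Z q) (X q) + g.inner q (Z' q) (X q) := by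
      ext q; simp
    simp only [koszul, e1, e2, mvfderiv_fun_add h1 h1', mvfderiv_fun_add h2 h2',
      VectorField.mlieBracket_add_left hZ hZ']
    simp
    ring

theorem exists_sharp (g : RiemMetric I M) (p : M) (l : TangentSpace I p →L[ℝ] ℝ) :
    ∃ v : TangentSpace I p, ∀ z, g.inner p v z = l z := by
  have : FiniteDimensional ℝ (TangentSpace I p) := inferInstanceAs (FiniteDimensional ℝ E)
  let B : LinearMap.BilinForm ℝ (TangentSpace I p) :=
    LinearMap.mk₂ ℝ (fun v z => g.inner p v z) (by simp) (by simp) (by simp) (by simp)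
  let T : TangentSpace I p →ₗ[ℝ] Dual ℝ (TangentSpace I p) := B
  have hT : Function.Injective T := by
    rw [← LinearMap.ker_eq_bot, LinearMap.ker_eq_bot']
    intro v hv
    by_contra h
    have h1 := g.pos p v h
    have h2 : T v v = 0 := by rw [hv]; rfl
    have h3 : T v v = g.inner p v v := rfl
    linarith
  have hs : Function.Surjective T :=
    (LinearMap.injective_iff_surjective_of_finrank_eq_finrank
      (Subspace.dual_finrank_eq (K := ℝ) (V := TangentSpace I p)).symm).1 hT
  obtain ⟨v, hv⟩ := hs l.toLinearMap
  exact ⟨v, fun z => by have := LinearMap.congr_fun hv z; exact this⟩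

open Classical in
/-- The Levi-Civita connection of `g`: `leviCivita g X Y p` is `(∇_X Y)(p)`, the tangent vector that
represents, through the metric, the linear form `Z ↦ koszul g X Y Z p`. (The value is `0` where `X`
or `Y` is not differentiable.) -/
def leviCivita (g : RiemMetric I M) (X Y : ∀ p : M, TangentSpace I p) (p : M) :
    TangentSpace I p :=
  if h : MDifferentiableAt I I.tangent (fun q => (⟨q, X q⟩ : TangentBundle I M)) p ∧
      MDifferentiableAt I I.tangent (fun q => (⟨q, Y q⟩ : TangentBundle I M)) p then
    (exists_sharp g p
      (TensorialAt.mkHom (fun Z => koszul g X Y Z p) p (koszul_tensorial g h.1 h.2))).choose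
  else 0

/-- The Koszul formula characterizes the Levi-Civita connection. -/
theorem inner_leviCivita (g : RiemMetric I M) {X Y Z : ∀ p : M, TangentSpace I p} {p : M}
    (hX : MDifferentiableAt I I.tangent (fun q => (⟨q, X q⟩ : TangentBundle I M)) p)
    (hY : MDifferentiableAt I I.tangent (fun q => (⟨q, Y q⟩ : TangentBundle I M)) p)
    (hZ : MDifferentiableAt I I.tangent (fun q => (⟨q, Z q⟩ : TangentBundle I M)) p) :
    g.inner p (leviCivita g X Y p) (Z p) = koszul g X Y Z p := by
  have h : MDifferentiableAt I I.tangent (fun q => (⟨q, X q⟩ : TangentBundle I M)) p ∧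
      MDifferentiableAt I I.tangent (fun q => (⟨q, Y q⟩ : TangentBundle I M)) p := ⟨hX, hY⟩
  rw [leviCivita, dif_pos h]
  have h1 := (exists_sharp g p
      (TensorialAt.mkHom (fun Z => koszul g X Y Z p) p (koszul_tensorial g h.1 h.2))).choose_spec
  rw [h1 (Z p), TensorialAt.mkHom_apply _ hZ]

/-! ### Almost paracontact paracomplex Riemannian structures -/

/-- An almost paracontact paracomplex Riemannian structure `(φ, ξ, η, g)` of type `(n, n)` on a
manifold `M` of dimension `2 * n + 1`. -/
structure ApcpcR (n : ℕ) (I : ModelWithCorners ℝ E H) (M : Type*) [TopologicalSpace M]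
    [ChartedSpace H M] [IsManifold I ∞ M] where
  /-- the `(1,1)`-tensor field `φ` -/
  phi : ∀ p : M, TangentSpace I p →L[ℝ] TangentSpace I p
  /-- the vector field `ξ` -/
  xi : ∀ p : M, TangentSpace I p
  /-- the `1`-form `η` -/
  eta : ∀ p : M, TangentSpace I p →L[ℝ] ℝ
  /-- the Riemannian metric `g` -/
  g : RiemMetric I M
  smooth_phi : ContMDiff I (I.prod 𝓘(ℝ, E →L[ℝ] E)) ∞ (fun p => TotalSpace.mk' (E →L[ℝ] E)
    (E := fun q : M => TangentSpace I q →L[ℝ] TangentSpace I q) p (phi p))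
  smooth_xi : IsSmoothField I xi
  smooth_eta : ContMDiff I (I.prod 𝓘(ℝ, E →L[ℝ] ℝ)) ∞ (fun p => TotalSpace.mk' (E →L[ℝ] ℝ)
    (E := fun q : M => TangentSpace I q →L[ℝ] ℝ) p (eta p))
  dim_eq : finrank ℝ E = 2 * n + 1
  phi_phi : ∀ (p : M) (x : TangentSpace I p), phi p (phi p x) = x - eta p x • xi p
  eta_xi : ∀ p : M, eta p (xi p) = 1
  /-- The eigenspaces of `φ` for `1` and `-1` (both lie in `ker η`) have dimension `n`. -/
  finrank_eigenspace_one : ∀ p : M,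
    finrank ℝ (End.eigenspace (phi p : TangentSpace I p →ₗ[ℝ] TangentSpace I p) 1) = n
  finrank_eigenspace_neg_one : ∀ p : M,
    finrank ℝ (End.eigenspace (phi p : TangentSpace I p →ₗ[ℝ] TangentSpace I p) (-1)) = n
  g_xi : ∀ (p : M) (x : TangentSpace I p), g.inner p x (xi p) = eta p x
  g_phi_phi : ∀ (p : M) (x y : TangentSpace I p),
    g.inner p (phi p x) (phi p y) = g.inner p x y - eta p x * eta p y

namespace ApcpcR

variable {n : ℕ} (S : ApcpcR n I M)

/-- The structure tensor `F(X, Y, Z) = g((∇_X φ) Y, Z)`, where `(∇_X φ) Y = ∇_X (φ Y) - φ (∇_X Y)`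
and `∇` is the Levi-Civita connection of `g`. -/
def F (X Y Z : ∀ p : M, TangentSpace I p) (p : M) : ℝ :=
  S.g.inner p (leviCivita S.g X (fun q => S.phi q (Y q)) p - S.phi p (leviCivita S.g X Y p)) (Z p)

/-- `X` is a smooth horizontal vector field, i.e. a smooth section of `H = ker η`. -/
def IsHorizontal (X : ∀ p : M, TangentSpace I p) : Prop :=
  IsSmoothField I X ∧ ∀ p, S.eta p (X p) = 0

/-- The structure is para-Sasaki-like: `F(X, Y, Z) = F(ξ, Y, Z) = F(ξ, ξ, Z) = 0` and
`F(X, Y, ξ) = -g(X, Y)` for all horizontal vector fields `X`, `Y`, `Z`. -/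
def IsParaSasakiLike : Prop :=
  ∀ X Y Z : ∀ p : M, TangentSpace I p,
    S.IsHorizontal X → S.IsHorizontal Y → S.IsHorizontal Z → ∀ p : M,
      S.F X Y Z p = 0 ∧ S.F S.xi Y Z p = 0 ∧ S.F S.xi S.xi Z p = 0 ∧
        S.F X Y S.xi p = - S.g.inner p (X p) (Y p)

/-! ### Paracontact conformal transformations -/

theorem phi_xi (p : M) : S.phi p (S.xi p) = 0 := by
  have h := S.g_phi_phi p (S.xi p) (S.xi p)
  rw [S.g_xi, S.eta_xi] at h
  by_contra h0
  have := S.g.pos p _ h0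
  linarith

theorem eta_phi (p : M) (x : TangentSpace I p) : S.eta p (S.phi p x) = 0 := by
  have h := S.phi_phi p (S.phi p x)
  rw [S.phi_phi p x, map_sub, map_smul, S.phi_xi, smul_zero, sub_zero] at h
  have h1 := congrArg (S.eta p) h
  rw [map_sub, map_smul, S.eta_xi, smul_eq_mul] at h1
  linarith

theorem g_phi_comm (p : M) (x y : TangentSpace I p) :
    S.g.inner p (S.phi p x) y = S.g.inner p x (S.phi p y) := by
  have h := S.g_phi_phi p x (S.phi p y)
  rw [S.phi_phi, S.eta_phi] at h
  simp [S.g_xi, S.eta_phi] at h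
  exact h

/-- The transformed metric
`e^{2u} cosh(2v) g(x, y) + e^{2u} sinh(2v) g(x, φ y) + (e^{2w} - e^{2u} cosh(2v)) η(x) η(y)` as a
bilinear form; here `u`, `v`, `w` are the values of the functions at `p`. The middle term is written
with `g(φ x, y)`, which equals `g(x, φ y)`. -/
def conformalInner (u v w : ℝ) (p : M) : TangentSpace I p →L[ℝ] TangentSpace I p →L[ℝ] ℝ :=
  (Real.exp (2 * u) * Real.cosh (2 * v)) • S.g.inner p
    + (Real.exp (2 * u) * Real.sinh (2 * v)) • (S.g.inner p).comp (S.phi p)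
    + (Real.exp (2 * w) - Real.exp (2 * u) * Real.cosh (2 * v)) •
        (S.eta p).smulRight (S.eta p)

theorem conformalInner_apply (u v w : ℝ) (p : M) (x y : TangentSpace I p) :
    S.conformalInner u v w p x y =
      Real.exp (2 * u) * Real.cosh (2 * v) * S.g.inner p x y
        + Real.exp (2 * u) * Real.sinh (2 * v) * S.g.inner p x (S.phi p y)
        + (Real.exp (2 * w) - Real.exp (2 * u) * Real.cosh (2 * v)) *
          (S.eta p x * S.eta p y) := by
  rw [← S.g_phi_comm]
  rfl

theorem le_conformalInner (u v w : ℝ) (p : M) (x : TangentSpace I p) :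
    min (Real.exp (2 * u - 2 * |v|)) (Real.exp (2 * w)) * S.g.inner p x x
      ≤ S.conformalInner u v w p x x := by
  have hnn : ∀ z : TangentSpace I p, 0 ≤ S.g.inner p z z := by
    intro z
    by_cases hz : z = 0
    · simp [hz]
    · exact (S.g.pos p z hz).le
  have h1 := S.g_phi_phi p x x
  have h2 := S.g_phi_phi p (S.phi p x) (S.phi p x)
  have h3 := S.g_phi_phi p x (S.phi p x)
  have h4 := S.g.symm p (S.phi p x) (S.phi p (S.phi p x))
  rw [S.eta_phi] at h2 h3
  have hp := hnn (S.phi p x + S.phi p (S.phi p x))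
  have hm := hnn (S.phi p x - S.phi p (S.phi p x))
  simp only [map_add, map_sub, add_apply, sub_apply]
    at hp hm
  rw [S.conformalInner_apply]
  set G := S.g.inner p x x
  set b := S.g.inner p x (S.phi p x)
  set t := S.eta p x
  set a := S.g.inner p (S.phi p x) (S.phi p x)
  set c := min (Real.exp (2 * u - 2 * |v|)) (Real.exp (2 * w)) with hc
  have hab : 0 ≤ a + b := by linarith
  have hab' : 0 ≤ a - b := by linarith
  have hc1 : c ≤ Real.exp (2 * u) * Real.exp (2 * v) := by
    rw [← Real.exp_add]
    exact (min_le_left _ _).trans (Real.exp_le_exp.2 (by linarith [neg_abs_le v]))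
  have hc2 : c ≤ Real.exp (2 * u) * Real.exp (-(2 * v)) := by
    rw [← Real.exp_add]
    exact (min_le_left _ _).trans (Real.exp_le_exp.2 (by linarith [le_abs_self v]))
  have hc3 : c ≤ Real.exp (2 * w) := min_le_right _ _
  have m1 := mul_le_mul_of_nonneg_right hc1 hab
  have m2 := mul_le_mul_of_nonneg_right hc2 hab'
  have m3 := mul_le_mul_of_nonneg_right hc3 (mul_self_nonneg t)
  have hG : G = a + t * t := by linarith
  rw [Real.cosh_eq, Real.sinh_eq, hG]
  linarith

theorem conformalInner_pos (u v w : ℝ) (p : M) (x : TangentSpace I p) (hx : x ≠ 0) :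
    0 < S.conformalInner u v w p x x :=
  (mul_pos (lt_min (Real.exp_pos _) (Real.exp_pos _)) (S.g.pos p x hx)).trans_le
    (S.le_conformalInner u v w p x)

theorem conformalInner_isVonNBounded (u v w : ℝ) (p : M) :
    Bornology.IsVonNBounded ℝ {x : TangentSpace I p | S.conformalInner u v w p x x < 1} := by
  set c := min (Real.exp (2 * u - 2 * |v|)) (Real.exp (2 * w)) with hc
  have hc0 : 0 < c := lt_min (Real.exp_pos _) (Real.exp_pos _)
  have hs : 0 < Real.sqrt c := Real.sqrt_pos.2 hc0
  refine Bornology.IsVonNBounded.subset ?_ ((S.g.isVonNBounded p).image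
    ((Real.sqrt c)⁻¹ • ContinuousLinearMap.id ℝ (TangentSpace I p)))
  intro x hx
  refine ⟨Real.sqrt c • x, ?_, ?_⟩
  · have h1 := S.le_conformalInner u v w p x
    have h2 : S.conformalInner u v w p x x < 1 := hx
    have h3 : Real.sqrt c * (Real.sqrt c * S.g.inner p x x) = c * S.g.inner p x x := by
      rw [← mul_assoc, Real.mul_self_sqrt hc0.le]
    simp only [Set.mem_ofPred_eq, map_smul, smul_apply, smul_eq_mul]
    rw [h3]
    exact h1.trans_lt h2
  · simp [smul_smul, mul_inv_cancel₀ hs.ne']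

theorem smooth_comp_phi {T : ∀ p : M, TangentSpace I p →L[ℝ] TangentSpace I p →L[ℝ] ℝ}
    (hT : ContMDiff I (I.prod 𝓘(ℝ, E →L[ℝ] E →L[ℝ] ℝ)) ∞
      (fun p => TotalSpace.mk' (E →L[ℝ] E →L[ℝ] ℝ)
        (E := fun q : M => TangentSpace I q →L[ℝ] TangentSpace I q →L[ℝ] ℝ) p (T p))) :
    ContMDiff I (I.prod 𝓘(ℝ, E →L[ℝ] E →L[ℝ] ℝ)) ∞
      (fun p => TotalSpace.mk' (E →L[ℝ] E →L[ℝ] ℝ)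
        (E := fun q : M => TangentSpace I q →L[ℝ] TangentSpace I q →L[ℝ] ℝ) p
        ((T p).comp (S.phi p))) := by
  intro p
  have h1 := hT p
  have h2 := S.smooth_phi p
  rw [contMDiffAt_hom_bundle] at h1 h2 ⊢
  refine ⟨contMDiffAt_id, ?_⟩
  refine (h1.2.clm_comp h2.2).congr_of_eventuallyEq ?_
  have hb := (trivializationAt E (TangentSpace I) p).open_baseSet.mem_nhds
    (mem_baseSet_trivializationAt E (TangentSpace I) p)
  filter_upwards [hb] with q hq
  ext x
  simp only [ContinuousLinearMap.inCoordinates, ContinuousLinearMap.comp_apply]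
  rw [Trivialization.symmL_continuousLinearMapAt _ hq]

/-- The transformed Riemannian metric. -/
def conformalMetric (u v w : C^∞⟮I, M; ℝ⟯) : RiemMetric I M where
  inner p := S.conformalInner (u p) (v p) (w p) p
  symm p x y := by
    rw [S.conformalInner_apply, S.conformalInner_apply, S.g.symm p x y, ← S.g_phi_comm,
      S.g.symm p (S.phi p x) y, mul_comm (S.eta p x)]
  pos p x hx := S.conformalInner_pos _ _ _ p x hx
  isVonNBounded p := S.conformalInner_isVonNBounded _ _ _ p
  contMDiff := by
    have h0 := S.g.contMDiff
    have h1 := S.smooth_comp_phi h0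
    have h2 := S.smooth_comp_phi h1
    have c1 : ContMDiff I 𝓘(ℝ, ℝ) ∞ (fun p => Real.exp (2 * u p) * Real.cosh (2 * v p)) := by
      exact ContMDiff.mul
        (Real.contDiff_exp.contMDiff.comp (contMDiff_const.mul u.contMDiff))
        (Real.contDiff_cosh.contMDiff.comp (contMDiff_const.mul v.contMDiff))
    have c2 : ContMDiff I 𝓘(ℝ, ℝ) ∞ (fun p => Real.exp (2 * u p) * Real.sinh (2 * v p)) :=
      ContMDiff.mul
        (Real.contDiff_exp.contMDiff.comp (contMDiff_const.mul u.contMDiff))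
        (Real.contDiff_sinh.contMDiff.comp (contMDiff_const.mul v.contMDiff))
    have c3 : ContMDiff I 𝓘(ℝ, ℝ) ∞ (fun p => Real.exp (2 * w p)) :=
      Real.contDiff_exp.contMDiff.comp (contMDiff_const.mul w.contMDiff)
    have key := ((ContMDiff.smul_section c1 h2).add_section
      (ContMDiff.smul_section c2 h1)).add_section (ContMDiff.smul_section c3 (h0.sub_section h2))
    refine key.congr fun p => ?_
    refine congrArg _ ?_
    ext x y
    rw [S.conformalInner_apply]
    change _ = Real.exp (2 * u p) * Real.cosh (2 * v p)
        * S.g.inner p (S.phi p (S.phi p x)) y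
      + Real.exp (2 * u p) * Real.sinh (2 * v p) * S.g.inner p (S.phi p x) y
      + Real.exp (2 * w p) * (S.g.inner p x y - S.g.inner p (S.phi p (S.phi p x)) y)
    rw [S.g_phi_comm p (S.phi p x) y, S.g_phi_phi, S.g_phi_comm]
    ring

/-- The paracontact conformal transformation of `(φ, ξ, η, g)` with the smooth functions `u`, `v`,
`w`: the structure `(φ, e^{-w} ξ, e^w η, conformalMetric u v w)`. -/
def conformal (u v w : C^∞⟮I, M; ℝ⟯) : ApcpcR n I M where
  phi := S.phi
  xi p := Real.exp (-w p) • S.xi p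
  eta p := Real.exp (w p) • S.eta p
  g := S.conformalMetric u v w
  smooth_phi := S.smooth_phi
  smooth_xi := by
    have c : ContMDiff I 𝓘(ℝ, ℝ) ∞ (fun p => Real.exp (-w p)) :=
      Real.contDiff_exp.contMDiff.comp w.contMDiff.neg
    exact ContMDiff.smul_section c S.smooth_xi
  smooth_eta := by
    have c : ContMDiff I 𝓘(ℝ, ℝ) ∞ (fun p => Real.exp (w p)) :=
      Real.contDiff_exp.contMDiff.comp w.contMDiff
    exact ContMDiff.smul_section c S.smooth_eta
  dim_eq := S.dim_eq
  phi_phi p x := by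
    rw [S.phi_phi, smul_apply, smul_smul, smul_eq_mul, mul_right_comm, ← Real.exp_add]
    simp
  eta_xi p := by
    rw [smul_apply, map_smul, S.eta_xi, smul_eq_mul, smul_eq_mul, mul_one, ← Real.exp_add]
    simp
  finrank_eigenspace_one := S.finrank_eigenspace_one
  finrank_eigenspace_neg_one := S.finrank_eigenspace_neg_one
  g_xi p x := by
    change S.conformalInner (u p) (v p) (w p) p x (Real.exp (-w p) • S.xi p) = _
    rw [map_smul, S.conformalInner_apply, S.phi_xi, map_zero, S.g_xi, S.eta_xi, smul_apply,
      smul_eq_mul, smul_eq_mul]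
    have h : Real.exp (2 * w p) = Real.exp (w p) * Real.exp (w p) := by
      rw [← Real.exp_add]; ring_nf
    have h' : Real.exp (-w p) * Real.exp (w p) = 1 := by
      rw [← Real.exp_add]; simp
    rw [h]
    linear_combination (Real.exp (w p) * S.eta p x) * h'
  g_phi_phi p x y := by
    change S.conformalInner (u p) (v p) (w p) p (S.phi p x) (S.phi p y)
      = S.conformalInner (u p) (v p) (w p) p x y - _
    rw [S.conformalInner_apply, S.conformalInner_apply, S.g_phi_phi p x (S.phi p y),
      S.g_phi_phi p x y, S.eta_phi, S.eta_phi, smul_apply, smul_apply, smul_eq_mul, smul_eq_mul]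
    have h : Real.exp (2 * w p) = Real.exp (w p) * Real.exp (w p) := by
      rw [← Real.exp_add]; ring_nf
    rw [h]
    ring

end ApcpcR

end General

/-! ### Paraholomorphic functions -/

section Paraholomorphic

variable {E' : Type*} [NormedAddCommGroup E'] [NormedSpace ℝ E']
  {H' : Type*} [TopologicalSpace H'] (J : ModelWithCorners ℝ E' H')
  {N : Type*} [TopologicalSpace N] [ChartedSpace H' N]

/-- The algebra of paracomplex numbers `a + e b` with `e ^ 2 = 1`. -/
abbrev Paracomplex : Type := QuadraticAlgebra ℝ 1 0

/-- The paracomplex unit `e`. -/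
abbrev paraUnit : Paracomplex := QuadraticAlgebra.omega

/-- The paracomplex-valued function `u + e v`. -/
def paraFun (u v : N → ℝ) (x : N) : Paracomplex :=
  QuadraticAlgebra.C (u x) + paraUnit * QuadraticAlgebra.C (v x)

/-- The differential `du + e dv` of a paracomplex-valued function `u + e v`. -/
def paraDeriv (f : N → Paracomplex) (x : N) (X : TangentSpace J x) : Paracomplex :=
  ⟨mvfderiv J (fun y => (f y).re) x X, mvfderiv J (fun y => (f y).im) x X⟩

/-- A smooth function `f : N → Paracomplex` is paraholomorphic with respect to the almost
paracomplex structure `P` on `N` if `df ∘ P = e df`. -/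
structure IsParaholomorphic (P : ∀ x : N, TangentSpace J x →L[ℝ] TangentSpace J x)
    (f : N → Paracomplex) : Prop where
  smooth_re : ContMDiff J 𝓘(ℝ, ℝ) ∞ (fun x => (f x).re)
  smooth_im : ContMDiff J 𝓘(ℝ, ℝ) ∞ (fun x => (f x).im)
  deriv_comp : ∀ (x : N) (X : TangentSpace J x),
    paraDeriv J f x (P x X) = paraUnit * paraDeriv J f x X

end Paraholomorphic

/-! ### Integral submanifolds of the paracontact distribution -/

section Leaves

variable {E : Type*} [NormedAddCommGroup E] [NormedSpace ℝ E]
  {H : Type*} [TopologicalSpace H] {I : ModelWithCorners ℝ E H}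
  {M : Type*} [TopologicalSpace M] [ChartedSpace H M] [IsManifold I ∞ M]
  {E' : Type*} [NormedAddCommGroup E'] [NormedSpace ℝ E']
  {H' : Type*} [TopologicalSpace H'] (J : ModelWithCorners ℝ E' H')
  {N : Type*} [TopologicalSpace N] [ChartedSpace H' N]

namespace ApcpcR

variable {n : ℕ} (S : ApcpcR n I M)

/-- `i : N → M` is an (immersed) integral submanifold of the distribution `H = ker η`, that is
`TN = H`, and `P` is the restriction of `φ` to `TN = H`. -/
structure IsLeaf (i : N → M) (P : ∀ x : N, TangentSpace J x →L[ℝ] TangentSpace J x) : Prop where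
  smooth : ContMDiff J I ∞ i
  injective : ∀ x : N, Function.Injective (mfderiv J I i x)
  range_eq : ∀ (x : N) (y : TangentSpace I (i x)),
    S.eta (i x) y = 0 ↔ ∃ X : TangentSpace J x, mfderiv J I i x X = y
  phi_comp : ∀ (x : N) (X : TangentSpace J x),
    mfderiv J I i x (P x X) = S.phi (i x) (mfderiv J I i x X)

/-- `Φ : (a, b) × N → M` is a local splitting of `M` as a product of an interval with `N`, such
that `ξ = ∂/∂t` and `TN = H`, the structure `φ` being given on `H` by the endomorphism field `P` of
`TN`. -/
structure IsSplitting (a b : ℝ) (Φ : ℝ × N → M)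
    (P : ∀ x : N, TangentSpace J x →L[ℝ] TangentSpace J x) : Prop where
  lt : a < b
  smooth : ContMDiffOn (𝓘(ℝ, ℝ).prod J) I ∞ Φ (Ioo a b ×ˢ univ)
  deriv_t : ∀ t ∈ Ioo a b, ∀ x : N,
    mfderiv 𝓘(ℝ, ℝ) I (fun s : ℝ => Φ (s, x)) t (1 : ℝ) = S.xi (Φ (t, x))
  leaf : ∀ t ∈ Ioo a b, S.IsLeaf J (fun x => Φ (t, x)) P

end ApcpcR

end Leaves

end ParacontactGeometry

end

universe u

/-!
The proof works with local fields of eigenvectors of `φ`, for the eigenvalues `1` and `-1` on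
`ker η` and `0` on the line of `ξ`. On such fields the structure tensor is a multiple of the Koszul
expression, `F(X, Y, Z) = (δ - ζ) g(∇_X Y, Z)`, where `δ` and `ζ` are the eigenvalues of `Y` and `Z`
(`F_eq_mul_koszul`). As `F` is tensorial, the para-Sasaki-like condition is therefore a condition on
Koszul expressions of eigenfields (`isParaSasakiLike_iff_koszul`). In particular the flow
of `ξ` preserves the eigenbundles and scales the metric on each of them
(`IsParaSasakiLike.lieDerivative_xi`, `IsParaSasakiLike.inner_mlieBracket_xi_left`).

The conformal metric is proportional to `g` on each eigenbundle, by the factors `e^{2u + 2v}`,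
`e^{2u - 2v}` and `e^{2w}`. The terms of its Koszul expressions of eigenfields are those of `g`,
multiplied by these factors, and derivatives of the factors, so the two metrics can be compared
directly (`koszul_of_proportional`). This gives the
characterization on eigenvectors (`IsParaSasakiLike.conformal_iff`), which decomposition of tangent
vectors turns into equations of `1`-forms (`IsParaSasakiLike.conformal_iff_mvfderiv`). For this
`n ≥ 1` is needed: both eigenbundles contain nonzero vectors.

When `w = 0`, the equations say that `u` and `v` are constant along `ξ` and that `du = dv ∘ φ` on
`ker η`; restricted to one integral submanifold, the second condition is paraholomorphy of `u + e v`
(`IsLeaf.isParaholomorphic_iff`). To deduce it at a given point from paraholomorphy on all integral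
submanifolds, one needs an integral submanifold through that point
(`IsParaSasakiLike.exists_isLeaf`). It exists since `∇ξ = φ` is symmetric, so that `η` is
closed (`IsParaSasakiLike.eta_mlieBracket`): in a chart `η` has a primitive by the Poincaré lemma,
and the inverse function theorem parametrizes a level set of it
(`exists_integral_parametrization`).
-/

open Bundle FiberBundle Set Module
open scoped Manifold ContDiff

noncomputable section

namespace ParacontactGeometry

/-! ### Tensoriality of the structure tensor -/

section Tensoriality

variable {E : Type*} [NormedAddCommGroup E] [NormedSpace ℝ E]
  {H : Type*} [TopologicalSpace H] {I : ModelWithCorners ℝ E H}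
  {M : Type*} [TopologicalSpace M] [ChartedSpace H M] [IsManifold I ∞ M]

/-- The vector field `X` on `M` is differentiable at the point `p`. -/
abbrev IsDiffFieldAt (I : ModelWithCorners ℝ E H) {M : Type*} [TopologicalSpace M]
    [ChartedSpace H M] [IsManifold I ∞ M] (X : ∀ p : M, TangentSpace I p) (p : M) : Prop :=
  MDifferentiableAt I I.tangent (fun q => (⟨q, X q⟩ : TangentBundle I M)) p

theorem IsSmoothField.isDiffFieldAt {X : ∀ p : M, TangentSpace I p} (hX : IsSmoothField I X)
    (p : M) : IsDiffFieldAt I X p :=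
  (hX p).mdifferentiableAt (by simp)

/-- The Levi-Civita connection is compatible with the metric:
`g(∇_X Y, Z) + g(Y, ∇_X Z) = X g(Y, Z)`. -/
theorem koszul_add_koszul_swap (g : RiemMetric I M) (X Y Z : ∀ p : M, TangentSpace I p) (p : M) :
    koszul g X Y Z p + koszul g X Z Y p
      = mvfderiv I (fun q => g.inner q (Y q) (Z q)) p (X p) := by
  have e (V W : ∀ p : M, TangentSpace I p) :
      (fun q => g.inner q (V q) (W q)) = fun q => g.inner q (W q) (V q) :=
    funext fun q => g.symm q _ _
  rw [koszul, koszul, e Z Y, e X Z, e Y X, VectorField.mlieBracket_swap_apply (V := X) (W := Z),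
    VectorField.mlieBracket_swap_apply (V := Y) (W := X),
    VectorField.mlieBracket_swap_apply (V := Y) (W := Z)]
  simp only [map_neg, neg_apply]
  ring

namespace ApcpcR

variable {n : ℕ} (S : ApcpcR n I M)

theorem isDiffFieldAt_phi {X : ∀ p : M, TangentSpace I p} {p : M} (hX : IsDiffFieldAt I X p) :
    IsDiffFieldAt I (fun q => S.phi q (X q)) p :=
  MDifferentiableAt.clm_bundle_apply (F₁ := E) (F₂ := E)
    ((S.smooth_phi p).mdifferentiableAt (by simp)) hX

theorem phi_smul (f : M → ℝ) (Y : ∀ p : M, TangentSpace I p) :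
    (fun q => S.phi q ((f • Y) q)) = f • fun q => S.phi q (Y q) := by
  ext q; simp

theorem phi_add (Y Y' : ∀ p : M, TangentSpace I p) :
    (fun q => S.phi q ((Y + Y') q)) = (fun q => S.phi q (Y q)) + fun q => S.phi q (Y' q) := by
  ext q; simp

end ApcpcR

variable [FiniteDimensional ℝ E]

theorem exists_isSmoothField_apply_eq [T2Space M] (p : M) (x : TangentSpace I p) :
    ∃ X : ∀ q : M, TangentSpace I q, IsSmoothField I X ∧ X p = x := by
  obtain ⟨s, hs, hX⟩ := exists_contMDiffOn_extend (k := ∞) I E x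
  obtain ⟨u, hus, hu, hpu⟩ := mem_nhds_iff.1 hs
  obtain ⟨f, -, hf⟩ := (SmoothBumpFunction.nhds_basis_tsupport (I := I) p).mem_iff.1
    (hu.mem_nhds hpu)
  refine ⟨(f : M → ℝ) • extend E x, ?_, ?_⟩
  · exact ContMDiffOn.smul_section_of_tsupport f.contMDiff.contMDiffOn hu hf (hX.mono hus)
  · simp

theorem koszul_smul_left (g : RiemMetric I M) {X Y Z : ∀ p : M, TangentSpace I p} {f : M → ℝ}
    {p : M} (hf : MDifferentiableAt I 𝓘(ℝ, ℝ) f p)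
    (hX : IsDiffFieldAt I X p) (hY : IsDiffFieldAt I Y p) (hZ : IsDiffFieldAt I Z p) :
    koszul g (f • X) Y Z p = f p * koszul g X Y Z p := by
  have h1 := mdifferentiableAt_inner g hX hY
  have h2 := mdifferentiableAt_inner g hZ hX
  have e1 : (fun q => g.inner q ((f • X) q) (Y q)) = fun q => f q * g.inner q (X q) (Y q) := by
    ext q; simp
  have e2 : (fun q => g.inner q (Z q) ((f • X) q)) = fun q => f q * g.inner q (Z q) (X q) := by
    ext q; simp
  simp only [koszul, e1, e2, mvfderiv_fun_mul hf h1, mvfderiv_fun_mul hf h2,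
    VectorField.mlieBracket_smul_left hf hX, VectorField.mlieBracket_smul_right hf hX]
  simp [g.symm p (X p)]
  ring

theorem koszul_smul_middle (g : RiemMetric I M) {X Y Z : ∀ p : M, TangentSpace I p} {f : M → ℝ}
    {p : M} (hf : MDifferentiableAt I 𝓘(ℝ, ℝ) f p)
    (hX : IsDiffFieldAt I X p) (hY : IsDiffFieldAt I Y p) (hZ : IsDiffFieldAt I Z p) :
    koszul g X (f • Y) Z p
      = f p * koszul g X Y Z p + mvfderiv I f p (X p) * g.inner p (Y p) (Z p) := by
  have h1 := mdifferentiableAt_inner g hX hY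
  have h2 := mdifferentiableAt_inner g hY hZ
  have e1 : (fun q => g.inner q (X q) ((f • Y) q)) = fun q => f q * g.inner q (X q) (Y q) := by
    ext q; simp
  have e2 : (fun q => g.inner q ((f • Y) q) (Z q)) = fun q => f q * g.inner q (Y q) (Z q) := by
    ext q; simp
  simp only [koszul, e1, e2, mvfderiv_fun_mul hf h1, mvfderiv_fun_mul hf h2,
    VectorField.mlieBracket_smul_right hf hY]
  simp [g.symm p (X p)]
  ring

theorem koszul_add_left (g : RiemMetric I M) {X X' Y Z : ∀ p : M, TangentSpace I p} {p : M}
    (hX : IsDiffFieldAt I X p) (hX' : IsDiffFieldAt I X' p) (hY : IsDiffFieldAt I Y p)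
    (hZ : IsDiffFieldAt I Z p) :
    koszul g (X + X') Y Z p = koszul g X Y Z p + koszul g X' Y Z p := by
  have e1 : (fun q => g.inner q ((X + X') q) (Y q))
      = fun q => g.inner q (X q) (Y q) + g.inner q (X' q) (Y q) := by
    ext q; simp
  have e2 : (fun q => g.inner q (Z q) ((X + X') q))
      = fun q => g.inner q (Z q) (X q) + g.inner q (Z q) (X' q) := by
    ext q; simp
  simp only [koszul, e1, e2,
    mvfderiv_fun_add (mdifferentiableAt_inner g hX hY) (mdifferentiableAt_inner g hX' hY),
    mvfderiv_fun_add (mdifferentiableAt_inner g hZ hX) (mdifferentiableAt_inner g hZ hX'),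
    VectorField.mlieBracket_add_left hX hX', VectorField.mlieBracket_add_right hX hX']
  simp
  ring

theorem koszul_add_middle (g : RiemMetric I M) {X Y Y' Z : ∀ p : M, TangentSpace I p} {p : M}
    (hX : IsDiffFieldAt I X p) (hY : IsDiffFieldAt I Y p) (hY' : IsDiffFieldAt I Y' p)
    (hZ : IsDiffFieldAt I Z p) :
    koszul g X (Y + Y') Z p = koszul g X Y Z p + koszul g X Y' Z p := by
  have e1 : (fun q => g.inner q (X q) ((Y + Y') q))
      = fun q => g.inner q (X q) (Y q) + g.inner q (X q) (Y' q) := by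
    ext q; simp
  have e2 : (fun q => g.inner q ((Y + Y') q) (Z q))
      = fun q => g.inner q (Y q) (Z q) + g.inner q (Y' q) (Z q) := by
    ext q; simp
  simp only [koszul, e1, e2,
    mvfderiv_fun_add (mdifferentiableAt_inner g hX hY) (mdifferentiableAt_inner g hX hY'),
    mvfderiv_fun_add (mdifferentiableAt_inner g hY hZ) (mdifferentiableAt_inner g hY' hZ),
    VectorField.mlieBracket_add_right hY hY']
  simp
  ring

namespace ApcpcR

variable {n : ℕ} (S : ApcpcR n I M)

theorem F_eq_koszul {X Y Z : ∀ p : M, TangentSpace I p} {p : M} (hX : IsDiffFieldAt I X p)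
    (hY : IsDiffFieldAt I Y p) (hZ : IsDiffFieldAt I Z p) :
    S.F X Y Z p = koszul S.g X (fun q => S.phi q (Y q)) Z p
      - koszul S.g X Y (fun q => S.phi q (Z q)) p := by
  rw [← inner_leviCivita S.g hX (S.isDiffFieldAt_phi hY) hZ,
    ← inner_leviCivita S.g hX hY (S.isDiffFieldAt_phi hZ), ← S.g_phi_comm, F, map_sub]
  rfl

theorem F_tensorial_left {Y Z : ∀ p : M, TangentSpace I p} {p : M}
    (hY : IsDiffFieldAt I Y p) (hZ : IsDiffFieldAt I Z p) :
    TensorialAt I E (fun X => S.F X Y Z p) p where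
  smul {f X} hf hX := by
    rw [S.F_eq_koszul (hf.smul_section hX) hY hZ, S.F_eq_koszul hX hY hZ,
      koszul_smul_left S.g hf hX (S.isDiffFieldAt_phi hY) hZ,
      koszul_smul_left S.g hf hX hY (S.isDiffFieldAt_phi hZ), smul_eq_mul, mul_sub]
  add {X X'} hX hX' := by
    rw [S.F_eq_koszul (mdifferentiableAt_add_section hX hX') hY hZ, S.F_eq_koszul hX hY hZ,
      S.F_eq_koszul hX' hY hZ, koszul_add_left S.g hX hX' (S.isDiffFieldAt_phi hY) hZ,
      koszul_add_left S.g hX hX' hY (S.isDiffFieldAt_phi hZ)]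
    ring

theorem F_tensorial_middle {X Z : ∀ p : M, TangentSpace I p} {p : M}
    (hX : IsDiffFieldAt I X p) (hZ : IsDiffFieldAt I Z p) :
    TensorialAt I E (fun Y => S.F X Y Z p) p where
  smul {f Y} hf hY := by
    rw [S.F_eq_koszul hX (hf.smul_section hY) hZ, S.F_eq_koszul hX hY hZ, S.phi_smul,
      koszul_smul_middle S.g hf hX (S.isDiffFieldAt_phi hY) hZ,
      koszul_smul_middle S.g hf hX hY (S.isDiffFieldAt_phi hZ), smul_eq_mul, S.g_phi_comm]
    ring
  add {Y Y'} hY hY' := by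
    rw [S.F_eq_koszul hX (mdifferentiableAt_add_section hY hY') hZ, S.F_eq_koszul hX hY hZ,
      S.F_eq_koszul hX hY' hZ, S.phi_add,
      koszul_add_middle S.g hX (S.isDiffFieldAt_phi hY) (S.isDiffFieldAt_phi hY') hZ,
      koszul_add_middle S.g hX hY hY' (S.isDiffFieldAt_phi hZ)]
    ring

theorem F_tensorial_right (X Y : ∀ p : M, TangentSpace I p) (p : M) :
    TensorialAt I E (fun Z => S.F X Y Z p) p where
  smul {f Z} _ _ := by simp [F]
  add {Z Z'} _ _ := by simp [F]; ring

/-- The structure tensor `F` as a function of three tangent vectors at `p`. It is computed on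
arbitrary extensions of these vectors; by `F_eq_structureTensor` their choice does not matter. -/
def structureTensor (p : M) (x y z : TangentSpace I p) : ℝ :=
  S.F (extend E x) (extend E y) (extend E z) p

theorem F_eq_structureTensor {X Y Z : ∀ p : M, TangentSpace I p} {p : M}
    (hX : IsDiffFieldAt I X p) (hY : IsDiffFieldAt I Y p) (hZ : IsDiffFieldAt I Z p) :
    S.F X Y Z p = S.structureTensor p (X p) (Y p) (Z p) := by
  have hx := mdifferentiableAt_extend I E (X p)
  have hy := mdifferentiableAt_extend I E (Y p)
  have hz := mdifferentiableAt_extend I E (Z p)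
  rw [structureTensor]
  refine ((S.F_tensorial_left hY hZ).pointwise hX hx (by simp)).trans ?_
  refine ((S.F_tensorial_middle hx hZ).pointwise hY hy (by simp)).trans ?_
  exact (S.F_tensorial_right _ _ p).pointwise hZ hz (by simp)

theorem structureTensor_add_left (p : M) (x x' y z : TangentSpace I p) :
    S.structureTensor p (x + x') y z
      = S.structureTensor p x y z + S.structureTensor p x' y z := by
  have hx := mdifferentiableAt_extend I E x
  have hx' := mdifferentiableAt_extend I E x'
  have hy := mdifferentiableAt_extend I E y
  have hz := mdifferentiableAt_extend I E z
  have h := (S.F_tensorial_left hy hz).add hx hx'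
  rw [S.F_eq_structureTensor (mdifferentiableAt_add_section hx hx') hy hz] at h
  simpa [structureTensor] using h

theorem structureTensor_add_middle (p : M) (x y y' z : TangentSpace I p) :
    S.structureTensor p x (y + y') z
      = S.structureTensor p x y z + S.structureTensor p x y' z := by
  have hx := mdifferentiableAt_extend I E x
  have hy := mdifferentiableAt_extend I E y
  have hy' := mdifferentiableAt_extend I E y'
  have hz := mdifferentiableAt_extend I E z
  have h := (S.F_tensorial_middle hx hz).add hy hy'
  rw [S.F_eq_structureTensor hx (mdifferentiableAt_add_section hy hy') hz] at h
  simpa [structureTensor] using h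

theorem structureTensor_add_right (p : M) (x y z z' : TangentSpace I p) :
    S.structureTensor p x y (z + z')
      = S.structureTensor p x y z + S.structureTensor p x y z' := by
  simp [structureTensor, F]
  ring

theorem structureTensor_smul_left (p : M) (c : ℝ) (x y z : TangentSpace I p) :
    S.structureTensor p (c • x) y z = c * S.structureTensor p x y z := by
  have hx := mdifferentiableAt_extend I E x
  have hy := mdifferentiableAt_extend I E y
  have hz := mdifferentiableAt_extend I E z
  have hc : MDifferentiableAt I 𝓘(ℝ, ℝ) (fun _ : M => c) p := mdifferentiableAt_const
  have h := (S.F_tensorial_left hy hz).smul hc hx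
  rw [S.F_eq_structureTensor (hc.smul_section hx) hy hz] at h
  simpa [structureTensor] using h

theorem structureTensor_smul_middle (p : M) (c : ℝ) (x y z : TangentSpace I p) :
    S.structureTensor p x (c • y) z = c * S.structureTensor p x y z := by
  have hx := mdifferentiableAt_extend I E x
  have hy := mdifferentiableAt_extend I E y
  have hz := mdifferentiableAt_extend I E z
  have hc : MDifferentiableAt I 𝓘(ℝ, ℝ) (fun _ : M => c) p := mdifferentiableAt_const
  have h := (S.F_tensorial_middle hx hz).smul hc hy
  rw [S.F_eq_structureTensor hx (hc.smul_section hy) hz] at h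
  simpa [structureTensor] using h

theorem structureTensor_smul_right (p : M) (c : ℝ) (x y z : TangentSpace I p) :
    S.structureTensor p x y (c • z) = c * S.structureTensor p x y z := by
  simp [structureTensor, F]

end ApcpcR

end Tensoriality

/-! ### Eigenfields of `φ` -/

section Eigenfields

variable {E : Type*} [NormedAddCommGroup E] [NormedSpace ℝ E]
  {H : Type*} [TopologicalSpace H] {I : ModelWithCorners ℝ E H}
  {M : Type*} [TopologicalSpace M] [ChartedSpace H M] [IsManifold I ∞ M]

namespace ApcpcR

/-- `ker η` is the sum of the eigenspaces of `φ` for `1` and `-1`. -/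
theorem exists_eq_add_of_eta_eq_zero {n : ℕ} (S : ApcpcR n I M) {p : M}
    {x : TangentSpace I p} (hx : S.eta p x = 0) :
    ∃ y z, x = y + z ∧ S.phi p y = (1 : ℝ) • y ∧ S.phi p z = (-1 : ℝ) • z := by
  have h := S.phi_phi p x
  rw [hx, zero_smul, sub_zero] at h
  refine ⟨(1 / 2 : ℝ) • (x + S.phi p x), (1 / 2 : ℝ) • (x - S.phi p x), ?_, ?_, ?_⟩
  · module
  · rw [map_smul, map_add, h]; module
  · rw [map_smul, map_sub, h]; module

end ApcpcR

variable [FiniteDimensional ℝ E]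

namespace ApcpcR

variable {n : ℕ} (S : ApcpcR n I M)

/-- `X` is differentiable at `p` and is, everywhere on `M`, an eigenvector of `φ` for the constant
eigenvalue `ε`. (Only the values of `X` near `p` matter for what happens at `p`, but the global
identity costs nothing: it survives cutting off and projecting.) -/
structure IsEigenfieldAt (ε : ℝ) (X : ∀ p : M, TangentSpace I p) (p : M) : Prop where
  diff : IsDiffFieldAt I X p
  phi_eq : ∀ q, S.phi q (X q) = ε • X q

variable {S} {p : M}

theorem eta_eq_zero_of_phi_eq {ε : ℝ} (hε : ε * ε = 1) {x : TangentSpace I p}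
    (hx : S.phi p x = ε • x) : S.eta p x = 0 := by
  have h := S.eta_phi p x
  rw [hx, map_smul, smul_eq_mul] at h
  rcases mul_eq_zero.1 h with h0 | h0
  · simp [h0] at hε
  · exact h0

theorem g_eq_zero_of_phi_eq {ε δ : ℝ} (h : ε ≠ δ) {x y : TangentSpace I p}
    (hx : S.phi p x = ε • x) (hy : S.phi p y = δ • y) : S.g.inner p x y = 0 := by
  have h1 := S.g_phi_comm p x y
  rw [hx, hy] at h1
  simp only [map_smul, smul_apply, smul_eq_mul] at h1
  rcases mul_eq_zero.1 (show (ε - δ) * S.g.inner p x y = 0 by linarith) with h0 | h0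
  · exact absurd (sub_eq_zero.1 h0) h
  · exact h0

theorem phi_phi_phi (x : TangentSpace I p) : S.phi p (S.phi p (S.phi p x)) = S.phi p x := by
  rw [S.phi_phi, S.eta_phi, zero_smul, sub_zero]

variable (S) in
theorem exists_isEigenfieldAt {ε : ℝ} (hε : ε * ε = 1) {x : TangentSpace I p}
    (hx : S.phi p x = ε • x) : ∃ X, S.IsEigenfieldAt ε X p ∧ X p = x := by
  have h0 : IsDiffFieldAt I (extend E x) p := mdifferentiableAt_extend I E x
  have h1 := S.isDiffFieldAt_phi h0
  have h2 := S.isDiffFieldAt_phi h1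
  refine ⟨fun q => (1 / 2 : ℝ) • (S.phi q (S.phi q (extend E x q)) + ε • S.phi q (extend E x q)),
    ⟨?_, fun q => ?_⟩, ?_⟩
  · have hc (c : ℝ) : MDifferentiableAt I 𝓘(ℝ, ℝ) (fun _ : M => c) p := mdifferentiableAt_const
    exact (hc _).smul_section (mdifferentiableAt_add_section h2 ((hc ε).smul_section h1))
  · simp only [map_smul, map_add, phi_phi_phi]
    linear_combination (norm := module) (-(1 / 2 : ℝ) * hε) • S.phi q (extend E x q)
  · simp only [extend_apply_self, hx, map_smul, smul_smul, hε]
    module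

theorem IsEigenfieldAt.eta_eq_zero {ε : ℝ} {X : ∀ p : M, TangentSpace I p}
    (hX : S.IsEigenfieldAt ε X p) (hε : ε * ε = 1) (q : M) : S.eta q (X q) = 0 :=
  eta_eq_zero_of_phi_eq hε (hX.phi_eq q)

variable (S) in
theorem isEigenfieldAt_xi (p : M) : S.IsEigenfieldAt 0 S.xi p :=
  ⟨S.smooth_xi.isDiffFieldAt p, fun q => by rw [S.phi_xi, zero_smul]⟩

/-- On eigenfields the structure tensor is a multiple of the Koszul expression: in
`g(∇_X (φ Y), Z) - g(∇_X Y, φ Z)` the endomorphism `φ` acts by constants. -/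
theorem F_eq_mul_koszul {δ ζ : ℝ} {X Y Z : ∀ p : M, TangentSpace I p}
    (hX : IsDiffFieldAt I X p) (hY : S.IsEigenfieldAt δ Y p) (hZ : S.IsEigenfieldAt ζ Z p) :
    S.F X Y Z p = (δ - ζ) * koszul S.g X Y Z p := by
  have hc (c : ℝ) : MDifferentiableAt I 𝓘(ℝ, ℝ) (fun _ : M => c) p := mdifferentiableAt_const
  have h1 := koszul_smul_middle S.g (hc δ) hX hY.diff hZ.diff
  have h2 := (koszul_tensorial S.g hX hY.diff).smul (hc ζ) hZ.diff
  have e1 : (fun q => S.phi q (Y q)) = (fun _ : M => δ) • Y := funext hY.phi_eq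
  have e2 : (fun q => S.phi q (Z q)) = (fun _ : M => ζ) • Z := funext hZ.phi_eq
  rw [S.F_eq_koszul hX hY.diff hZ.diff, e1, e2, h1, h2, mvfderiv_const]
  simp
  ring

variable (S) in
theorem isParaSasakiLike_iff_structureTensor [T2Space M] :
    S.IsParaSasakiLike ↔ ∀ (p : M) (x y z : TangentSpace I p),
      S.eta p x = 0 → S.eta p y = 0 → S.eta p z = 0 →
      S.structureTensor p x y z = 0 ∧ S.structureTensor p (S.xi p) y z = 0 ∧
        S.structureTensor p (S.xi p) (S.xi p) z = 0 ∧
        S.structureTensor p x y (S.xi p) = -S.g.inner p x y := by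
  have hext (p : M) (x : TangentSpace I p) (hx : S.eta p x = 0) :
      ∃ X, S.IsHorizontal X ∧ X p = x := by
    obtain ⟨X, hX, rfl⟩ := exists_isSmoothField_apply_eq p x
    have h (Y : ∀ q : M, TangentSpace I q) (hY : IsSmoothField I Y) :
        IsSmoothField I (fun q => S.phi q (Y q)) :=
      ContMDiff.clm_bundle_apply (F₁ := E) (F₂ := E) S.smooth_phi hY
    refine ⟨fun q => S.phi q (S.phi q (X q)), ⟨h _ (h X hX), fun q => S.eta_phi q _⟩, ?_⟩
    simp only [S.phi_phi, hx, zero_smul, sub_zero]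
  have hξ (p : M) := S.smooth_xi.isDiffFieldAt p
  constructor
  · intro h p x y z hx hy hz
    obtain ⟨X, hX, rfl⟩ := hext p x hx
    obtain ⟨Y, hY, rfl⟩ := hext p y hy
    obtain ⟨Z, hZ, rfl⟩ := hext p z hz
    have := h X Y Z hX hY hZ p
    rwa [S.F_eq_structureTensor (hX.1.isDiffFieldAt p) (hY.1.isDiffFieldAt p)
      (hZ.1.isDiffFieldAt p), S.F_eq_structureTensor (hξ p) (hY.1.isDiffFieldAt p)
      (hZ.1.isDiffFieldAt p), S.F_eq_structureTensor (hξ p) (hξ p) (hZ.1.isDiffFieldAt p),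
      S.F_eq_structureTensor (hX.1.isDiffFieldAt p) (hY.1.isDiffFieldAt p) (hξ p)] at this
  · intro h X Y Z hX hY hZ p
    rw [S.F_eq_structureTensor (hX.1.isDiffFieldAt p) (hY.1.isDiffFieldAt p)
      (hZ.1.isDiffFieldAt p), S.F_eq_structureTensor (hξ p) (hY.1.isDiffFieldAt p)
      (hZ.1.isDiffFieldAt p), S.F_eq_structureTensor (hξ p) (hξ p) (hZ.1.isDiffFieldAt p),
      S.F_eq_structureTensor (hX.1.isDiffFieldAt p) (hY.1.isDiffFieldAt p) (hξ p)]
    exact h p _ _ _ (hX.2 p) (hY.2 p) (hZ.2 p)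

variable (S) in
/-- It suffices to test the para-Sasaki-like condition on eigenfields of `φ`, where it becomes a
condition on Koszul expressions. In place of `ξ` any vector field `Ξ` proportional to it may be
used. -/
theorem isParaSasakiLike_iff_koszul [T2Space M] {c : M → ℝ} {Ξ : ∀ p : M, TangentSpace I p}
    (hc : ∀ p, c p ≠ 0) (hΞ : IsSmoothField I Ξ) (hcΞ : ∀ p, S.xi p = c p • Ξ p) :
    S.IsParaSasakiLike ↔ ∀ (p : M) (ε δ ζ : ℝ), ε * ε = 1 → δ * δ = 1 → ζ * ζ = 1 →
      ∀ X Y Z : ∀ p : M, TangentSpace I p,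
      S.IsEigenfieldAt ε X p → S.IsEigenfieldAt δ Y p → S.IsEigenfieldAt ζ Z p →
      (δ - ζ) * koszul S.g X Y Z p = 0 ∧ (δ - ζ) * koszul S.g Ξ Y Z p = 0 ∧
        koszul S.g Ξ Ξ Z p = 0 ∧
        c p * (δ * koszul S.g X Y Ξ p) = -S.g.inner p (X p) (Y p) := by
  have hΞp (p : M) : S.IsEigenfieldAt 0 Ξ p := by
    refine ⟨hΞ.isDiffFieldAt p, fun q => ?_⟩
    have := S.phi_xi q
    rw [hcΞ, map_smul] at this
    rw [(smul_eq_zero.1 this).resolve_left (hc q), zero_smul]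
  -- the four quantities for eigenfields
  have key (p : M) (ε δ ζ : ℝ) (hζ : ζ * ζ = 1)
      (X Y Z : ∀ p : M, TangentSpace I p) (hX : S.IsEigenfieldAt ε X p)
      (hY : S.IsEigenfieldAt δ Y p) (hZ : S.IsEigenfieldAt ζ Z p) :
      (S.structureTensor p (X p) (Y p) (Z p) = 0 ∧ S.structureTensor p (S.xi p) (Y p) (Z p) = 0 ∧
        S.structureTensor p (S.xi p) (S.xi p) (Z p) = 0 ∧
        S.structureTensor p (X p) (Y p) (S.xi p) = -S.g.inner p (X p) (Y p)) ↔
      ((δ - ζ) * koszul S.g X Y Z p = 0 ∧ (δ - ζ) * koszul S.g Ξ Y Z p = 0 ∧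
        koszul S.g Ξ Ξ Z p = 0 ∧
        c p * (δ * koszul S.g X Y Ξ p) = -S.g.inner p (X p) (Y p)) := by
    have hζ0 : ζ ≠ 0 := fun h => by simp [h] at hζ
    rw [hcΞ p, structureTensor_smul_left, structureTensor_smul_left, structureTensor_smul_middle,
      structureTensor_smul_right, ← S.F_eq_structureTensor hX.diff hY.diff hZ.diff,
      ← S.F_eq_structureTensor (hΞp p).diff hY.diff hZ.diff,
      ← S.F_eq_structureTensor (hΞp p).diff (hΞp p).diff hZ.diff,
      ← S.F_eq_structureTensor hX.diff hY.diff (hΞp p).diff,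
      F_eq_mul_koszul hX.diff hY hZ, F_eq_mul_koszul (hΞp p).diff hY hZ,
      F_eq_mul_koszul (hΞp p).diff (hΞp p) hZ, F_eq_mul_koszul hX.diff hY (hΞp p)]
    simp [hc p, hζ0]
  rw [S.isParaSasakiLike_iff_structureTensor]
  constructor
  · intro h p ε δ ζ hε hδ hζ X Y Z hX hY hZ
    exact (key p ε δ ζ hζ X Y Z hX hY hZ).1
      (h p _ _ _ (hX.eta_eq_zero hε p) (hY.eta_eq_zero hδ p) (hZ.eta_eq_zero hζ p))
  · intro h p
    have h' (ε δ ζ : ℝ) (hε : ε * ε = 1) (hδ : δ * δ = 1) (hζ : ζ * ζ = 1)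
        {x y z : TangentSpace I p} (hx : S.phi p x = ε • x) (hy : S.phi p y = δ • y)
        (hz : S.phi p z = ζ • z) :
        S.structureTensor p x y z = 0 ∧ S.structureTensor p (S.xi p) y z = 0 ∧
          S.structureTensor p (S.xi p) (S.xi p) z = 0 ∧
          S.structureTensor p x y (S.xi p) = -S.g.inner p x y := by
      obtain ⟨X, hX, rfl⟩ := S.exists_isEigenfieldAt hε hx
      obtain ⟨Y, hY, rfl⟩ := S.exists_isEigenfieldAt hδ hy
      obtain ⟨Z, hZ, rfl⟩ := S.exists_isEigenfieldAt hζ hz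
      exact (key p ε δ ζ hζ X Y Z hX hY hZ).2 (h p ε δ ζ hε hδ hζ X Y Z hX hY hZ)
    intro x y z hx hy hz
    obtain ⟨x₁, x₂, rfl, hx₁, hx₂⟩ := S.exists_eq_add_of_eta_eq_zero hx
    obtain ⟨y₁, y₂, rfl, hy₁, hy₂⟩ := S.exists_eq_add_of_eta_eq_zero hy
    obtain ⟨z₁, z₂, rfl, hz₁, hz₂⟩ := S.exists_eq_add_of_eta_eq_zero hz
    have h1 : (1 : ℝ) * 1 = 1 := by norm_num
    have h2 : (-1 : ℝ) * -1 = 1 := by norm_num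
    obtain ⟨a1, b1, c1, d1⟩ := h' 1 1 1 h1 h1 h1 hx₁ hy₁ hz₁
    obtain ⟨a2, b2, c2, -⟩ := h' 1 1 (-1) h1 h1 h2 hx₁ hy₁ hz₂
    obtain ⟨a3, b3, -, d3⟩ := h' 1 (-1) 1 h1 h2 h1 hx₁ hy₂ hz₁
    obtain ⟨a4, b4, -, -⟩ := h' 1 (-1) (-1) h1 h2 h2 hx₁ hy₂ hz₂
    obtain ⟨a5, -, -, d5⟩ := h' (-1) 1 1 h2 h1 h1 hx₂ hy₁ hz₁
    obtain ⟨a6, -, -, -⟩ := h' (-1) 1 (-1) h2 h1 h2 hx₂ hy₁ hz₂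
    obtain ⟨a7, -, -, d7⟩ := h' (-1) (-1) 1 h2 h2 h1 hx₂ hy₂ hz₁
    obtain ⟨a8, -, -, -⟩ := h' (-1) (-1) (-1) h2 h2 h2 hx₂ hy₂ hz₂
    refine ⟨?_, ?_, ?_, ?_⟩
    · simp [structureTensor_add_left, structureTensor_add_middle, structureTensor_add_right,
        a1, a2, a3, a4, a5, a6, a7, a8]
    · simp [structureTensor_add_middle, structureTensor_add_right, b1, b2, b3, b4]
    · simp [structureTensor_add_right, c1, c2]
    · simp only [structureTensor_add_left, structureTensor_add_middle, d1, d3, d5, d7, map_add,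
        add_apply]
      ring

end ApcpcR

end Eigenfields

/-! ### Consequences of the para-Sasaki-like condition for eigenfields -/

section Conformal

variable {E : Type*} [NormedAddCommGroup E] [NormedSpace ℝ E]
  {H : Type*} [TopologicalSpace H] {I : ModelWithCorners ℝ E H}
  {M : Type*} [TopologicalSpace M] [ChartedSpace H M] [IsManifold I ∞ M]

namespace ApcpcR

theorem mvfderiv_inner_xi_xi {n : ℕ} (S : ApcpcR n I M) {p : M} (x : TangentSpace I p) :
    mvfderiv I (fun q => S.g.inner q (S.xi q) (S.xi q)) p x = 0 := by
  have e : (fun q => S.g.inner q (S.xi q) (S.xi q)) = fun _ => 1 :=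
    funext fun q => by rw [S.g_xi, S.eta_xi]
  rw [e, mvfderiv_const]
  rfl

end ApcpcR

variable [FiniteDimensional ℝ E]

/-- The Koszul expression of a metric `g'` on vector fields on which `g'` differs from `g` by
factors: `g'(X, ·) = a g(X, ·)`, `g'(Y, ·) = b g(Y, ·)`, `g'(Z, ·) = c g(Z, ·)`. -/
theorem koszul_of_proportional {g g' : RiemMetric I M} {X Y Z : ∀ p : M, TangentSpace I p}
    {a b c : M → ℝ} {p : M} (hX : IsDiffFieldAt I X p) (hY : IsDiffFieldAt I Y p)
    (hZ : IsDiffFieldAt I Z p)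
    (ha : MDifferentiableAt I 𝓘(ℝ, ℝ) a p) (hb : MDifferentiableAt I 𝓘(ℝ, ℝ) b p)
    (hc : MDifferentiableAt I 𝓘(ℝ, ℝ) c p)
    (haX : ∀ q y, g'.inner q (X q) y = a q * g.inner q (X q) y)
    (hbY : ∀ q y, g'.inner q (Y q) y = b q * g.inner q (Y q) y)
    (hcZ : ∀ q y, g'.inner q (Z q) y = c q * g.inner q (Z q) y) :
    2 * koszul g' X Y Z p =
      mvfderiv I b p (X p) * g.inner p (Y p) (Z p) + mvfderiv I c p (Y p) * g.inner p (Z p) (X p)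
        - mvfderiv I a p (Z p) * g.inner p (X p) (Y p)
        + b p * mvfderiv I (fun q => g.inner q (Y q) (Z q)) p (X p)
        + c p * mvfderiv I (fun q => g.inner q (Z q) (X q)) p (Y p)
        - a p * mvfderiv I (fun q => g.inner q (X q) (Y q)) p (Z p)
        + c p * g.inner p (VectorField.mlieBracket I X Y p) (Z p)
        + b p * g.inner p (VectorField.mlieBracket I Z X p) (Y p)
        + a p * g.inner p (VectorField.mlieBracket I Z Y p) (X p) := by
  rw [koszul]
  simp only [haX, hbY, hcZ, mvfderiv_fun_mul hb (mdifferentiableAt_inner g hY hZ),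
    mvfderiv_fun_mul hc (mdifferentiableAt_inner g hZ hX),
    mvfderiv_fun_mul ha (mdifferentiableAt_inner g hX hY)]
  have hX' (y : TangentSpace I p) : g'.inner p y (X p) = a p * g.inner p y (X p) := by
    rw [g'.symm, haX, g.symm]
  have hY' (y : TangentSpace I p) : g'.inner p y (Y p) = b p * g.inner p y (Y p) := by
    rw [g'.symm, hbY, g.symm]
  have hZ' (y : TangentSpace I p) : g'.inner p y (Z p) = c p * g.inner p y (Z p) := by
    rw [g'.symm, hcZ, g.symm]
  rw [hX', hY', hZ']
  simp
  ring

namespace ApcpcR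

variable {n : ℕ} {S : ApcpcR n I M} {p : M} {X Y Z : ∀ p : M, TangentSpace I p} {ε δ : ℝ}

theorem IsEigenfieldAt.mvfderiv_inner_eq_zero (h : ε ≠ δ) (hX : S.IsEigenfieldAt ε X p)
    (hY : S.IsEigenfieldAt δ Y p) (x : TangentSpace I p) :
    mvfderiv I (fun q => S.g.inner q (X q) (Y q)) p x = 0 := by
  have e : (fun q => S.g.inner q (X q) (Y q)) = fun _ => 0 :=
    funext fun q => g_eq_zero_of_phi_eq h (hX.phi_eq q) (hY.phi_eq q)
  rw [e, mvfderiv_const]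
  rfl

section Brackets

variable [T2Space M]

theorem IsParaSasakiLike.koszul_eq (hS : S.IsParaSasakiLike) {ζ : ℝ} (hε : ε * ε = 1)
    (hδ : δ * δ = 1) (hζ : ζ * ζ = 1) (hX : S.IsEigenfieldAt ε X p)
    (hY : S.IsEigenfieldAt δ Y p) (hZ : S.IsEigenfieldAt ζ Z p) :
    (δ - ζ) * koszul S.g X Y Z p = 0 ∧ (δ - ζ) * koszul S.g S.xi Y Z p = 0 ∧
      koszul S.g S.xi S.xi Z p = 0 ∧
      koszul S.g X Y S.xi p = -(δ * S.g.inner p (X p) (Y p)) := by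
  obtain ⟨h1, h2, h3, h4⟩ := (S.isParaSasakiLike_iff_koszul (c := fun _ => 1)
    (fun _ => one_ne_zero) S.smooth_xi (fun p => (one_smul ℝ _).symm)).1 hS p ε δ ζ hε hδ hζ
      X Y Z hX hY hZ
  exact ⟨h1, h2, h3, by linear_combination δ * h4 - koszul S.g X Y S.xi p * hδ⟩

/-- In a para-Sasaki-like structure the distribution `ker η` is involutive. -/
theorem IsParaSasakiLike.inner_mlieBracket_xi (hS : S.IsParaSasakiLike) (hε : ε * ε = 1)
    (hδ : δ * δ = 1) (hX : S.IsEigenfieldAt ε X p) (hY : S.IsEigenfieldAt δ Y p) :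
    S.g.inner p (VectorField.mlieBracket I X Y p) (S.xi p) = 0 := by
  have h1 := (hS.koszul_eq hε hδ hδ hX hY hY).2.2.2
  have h2 := (hS.koszul_eq hδ hε hε hY hX hX).2.2.2
  have hε0 : ε ≠ 0 := fun h => by simp [h] at hε
  have hδ0 : δ ≠ 0 := fun h => by simp [h] at hδ
  have hξ := S.isEigenfieldAt_xi p
  have h3 : (ε - δ) * S.g.inner p (X p) (Y p) = 0 := by
    by_cases h : ε = δ
    · simp [h]
    · rw [g_eq_zero_of_phi_eq h (hX.phi_eq p) (hY.phi_eq p), mul_zero]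
  rw [koszul, hY.mvfderiv_inner_eq_zero hδ0 hξ, hξ.mvfderiv_inner_eq_zero hε0.symm hX] at h1
  rw [koszul, hX.mvfderiv_inner_eq_zero hε0 hξ, hξ.mvfderiv_inner_eq_zero hδ0.symm hY,
    VectorField.mlieBracket_swap_apply (V := Y), S.g.symm p (Y p) (X p)] at h2
  have e : (fun q => S.g.inner q (Y q) (X q)) = fun q => S.g.inner q (X q) (Y q) :=
    funext fun q => S.g.symm q _ _
  rw [e] at h2
  simp only [map_neg, neg_apply] at h2
  linear_combination h1 - h2 + h3

/-- The Lie derivative of the metric: `(L_ξ g)(X, Y) = 2 δ g(X, Y)` for an eigenfield `Y` of `φ`. -/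
theorem IsParaSasakiLike.lieDerivative_xi (hS : S.IsParaSasakiLike) (hε : ε * ε = 1)
    (hδ : δ * δ = 1) (hX : S.IsEigenfieldAt ε X p) (hY : S.IsEigenfieldAt δ Y p) :
    -mvfderiv I (fun q => S.g.inner q (X q) (Y q)) p (S.xi p)
      + S.g.inner p (VectorField.mlieBracket I S.xi X p) (Y p)
      + S.g.inner p (VectorField.mlieBracket I S.xi Y p) (X p)
      = -(2 * δ * S.g.inner p (X p) (Y p)) := by
  have h1 := (hS.koszul_eq hε hδ hδ hX hY hY).2.2.2
  have hε0 : ε ≠ 0 := fun h => by simp [h] at hε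
  have hδ0 : δ ≠ 0 := fun h => by simp [h] at hδ
  have hξ := S.isEigenfieldAt_xi p
  rw [koszul, hY.mvfderiv_inner_eq_zero hδ0 hξ, hξ.mvfderiv_inner_eq_zero hε0.symm hX,
    hS.inner_mlieBracket_xi hε hδ hX hY] at h1
  linear_combination 2 * h1

/-- The flow of `ξ` preserves, infinitesimally, both eigenspaces of `φ` on `ker η`. -/
theorem IsParaSasakiLike.inner_mlieBracket_xi_left (hS : S.IsParaSasakiLike) (hε : ε * ε = 1)
    (hδ : δ * δ = 1) (h : ε ≠ δ) (hX : S.IsEigenfieldAt ε X p) (hY : S.IsEigenfieldAt δ Y p) :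
    S.g.inner p (VectorField.mlieBracket I S.xi X p) (Y p) = 0 := by
  have h1 := hS.lieDerivative_xi hε hδ hX hY
  have h2 := (hS.koszul_eq hε hε hδ hX hX hY).2.1
  have hε0 : ε ≠ 0 := fun h => by simp [h] at hε
  have hδ0 : δ ≠ 0 := fun h => by simp [h] at hδ
  have hξ := S.isEigenfieldAt_xi p
  replace h2 := (mul_eq_zero.1 h2).resolve_left (sub_ne_zero.2 h)
  rw [koszul, hX.mvfderiv_inner_eq_zero h hY, hY.mvfderiv_inner_eq_zero hδ0 hξ,
    hξ.mvfderiv_inner_eq_zero hε0.symm hX, hS.inner_mlieBracket_xi hδ hε hY hX,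
    VectorField.mlieBracket_swap_apply (V := Y)] at h2
  rw [hX.mvfderiv_inner_eq_zero h hY,
    g_eq_zero_of_phi_eq h (hX.phi_eq p) (hY.phi_eq p)] at h1
  simp only [map_neg, neg_apply] at h2
  linear_combination h2 + 1 / 2 * h1

/-- Equivalent to `∇_ξ ξ = 0`: the integral curves of `ξ` are geodesics. -/
theorem IsParaSasakiLike.inner_mlieBracket_xi_right (hS : S.IsParaSasakiLike) (hε : ε * ε = 1)
    (hX : S.IsEigenfieldAt ε X p) :
    S.g.inner p (VectorField.mlieBracket I X S.xi p) (S.xi p) = 0 := by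
  have h := (hS.koszul_eq hε hε hε hX hX hX).2.2.1
  have hε0 : ε ≠ 0 := fun h => by simp [h] at hε
  have hξ := S.isEigenfieldAt_xi p
  rw [koszul, hξ.mvfderiv_inner_eq_zero hε0.symm hX, hX.mvfderiv_inner_eq_zero hε0 hξ,
    S.mvfderiv_inner_xi_xi, VectorField.mlieBracket_self] at h
  simp only [Pi.zero_apply, map_zero, zero_apply] at h
  linear_combination h

/-- The symmetric and the skew part of `g(∇_X Y, Z) = 0` for `X`, `Y` in one eigenbundle and `Z` in
the other. -/
theorem IsParaSasakiLike.eigenbundle_eqs (hS : S.IsParaSasakiLike) (hε : ε * ε = 1)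
    (hδ : δ * δ = 1) (h : ε ≠ δ) (hX : S.IsEigenfieldAt ε X p) (hY : S.IsEigenfieldAt ε Y p)
    (hZ : S.IsEigenfieldAt δ Z p) :
    S.g.inner p (VectorField.mlieBracket I X Y p) (Z p) = 0 ∧
    -mvfderiv I (fun q => S.g.inner q (X q) (Y q)) p (Z p)
      + S.g.inner p (VectorField.mlieBracket I Z X p) (Y p)
      + S.g.inner p (VectorField.mlieBracket I Z Y p) (X p) = 0 := by
  have h1 := (hS.koszul_eq hε hε hδ hX hY hZ).1
  have h2 := (hS.koszul_eq hε hε hδ hY hX hZ).1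
  replace h1 := (mul_eq_zero.1 h1).resolve_left (sub_ne_zero.2 h)
  replace h2 := (mul_eq_zero.1 h2).resolve_left (sub_ne_zero.2 h)
  have e : (fun q => S.g.inner q (Y q) (X q)) = fun q => S.g.inner q (X q) (Y q) :=
    funext fun q => S.g.symm q _ _
  rw [koszul, hY.mvfderiv_inner_eq_zero h hZ, hZ.mvfderiv_inner_eq_zero h.symm hX] at h1
  rw [koszul, hX.mvfderiv_inner_eq_zero h hZ, hZ.mvfderiv_inner_eq_zero h.symm hY, e,
    VectorField.mlieBracket_swap_apply (V := Y) (W := X)] at h2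
  simp only [map_neg, neg_apply] at h2
  constructor
  · linear_combination h1 - h2
  · linear_combination h1 + h2

end Brackets

end ApcpcR

end Conformal

/-! ### The Koszul formula of the conformal metric -/

section ConformalChange

variable {E : Type*} [NormedAddCommGroup E] [NormedSpace ℝ E]
  {H : Type*} [TopologicalSpace H] {I : ModelWithCorners ℝ E H}
  {M : Type*} [TopologicalSpace M] [ChartedSpace H M]

theorem mvfderiv_exp {f : M → ℝ} {p : M} (hf : MDifferentiableAt I 𝓘(ℝ, ℝ) f p)
    (x : TangentSpace I p) :
    mvfderiv I (fun q => Real.exp (f q)) p x = Real.exp (f p) * mvfderiv I f p x := by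
  have h := (Real.hasDerivAt_exp (f p)).hasFDerivAt.hasMFDerivAt.comp p hf.hasMFDerivAt
  have e : mfderiv I 𝓘(ℝ, ℝ) (fun q => Real.exp (f q)) p = _ := h.mfderiv
  rw [mvfderiv, mvfderiv, e]
  exact mul_comm _ _

theorem mdifferentiableAt_contMDiffMap (f : C^∞⟮I, M; ℝ⟯) (p : M) :
    MDifferentiableAt I 𝓘(ℝ, ℝ) f p :=
  (f.contMDiff p).mdifferentiableAt (by simp)

theorem mdifferentiableAt_exponent (u v : C^∞⟮I, M; ℝ⟯) (ε : ℝ) (p : M) :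
    MDifferentiableAt I 𝓘(ℝ, ℝ) (fun q => 2 * u q + 2 * ε * v q) p :=
  (mdifferentiableAt_const.mul (mdifferentiableAt_contMDiffMap u p)).add
    (mdifferentiableAt_const.mul (mdifferentiableAt_contMDiffMap v p))

theorem mvfderiv_exp_exponent (u v : C^∞⟮I, M; ℝ⟯) (ε : ℝ) {p : M} (x : TangentSpace I p) :
    mvfderiv I (fun q => Real.exp (2 * u q + 2 * ε * v q)) p x
      = Real.exp (2 * u p + 2 * ε * v p) *
        (2 * (mvfderiv I u p x + ε * mvfderiv I v p x)) := by
  have hu := mdifferentiableAt_contMDiffMap u p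
  have hv := mdifferentiableAt_contMDiffMap v p
  have hc (c : ℝ) : MDifferentiableAt I 𝓘(ℝ, ℝ) (fun _ : M => c) p := mdifferentiableAt_const
  have hu' : MDifferentiableAt I 𝓘(ℝ, ℝ) (fun q => 2 * u q) p := (hc _).mul hu
  have hv' : MDifferentiableAt I 𝓘(ℝ, ℝ) (fun q => 2 * ε * v q) p := (hc _).mul hv
  rw [mvfderiv_exp (mdifferentiableAt_exponent u v ε p),
    mvfderiv_fun_add hu' hv', mvfderiv_fun_mul (hc _) hu,
    mvfderiv_fun_mul (hc _) hv, mvfderiv_const, mvfderiv_const]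
  simp
  ring

theorem mdifferentiableAt_exp_exponent (u v : C^∞⟮I, M; ℝ⟯) (ε : ℝ) (p : M) :
    MDifferentiableAt I 𝓘(ℝ, ℝ) (fun q => Real.exp (2 * u q + 2 * ε * v q)) p :=
  MDifferentiableAt.comp (g := Real.exp) p
    Real.differentiable_exp.differentiableAt.mdifferentiableAt
    (mdifferentiableAt_exponent u v ε p)

theorem exp_exponent_zero (w : C^∞⟮I, M; ℝ⟯) :
    (fun q => Real.exp (2 * w q + 2 * 0 * w q)) = fun q => Real.exp (2 * w q) := by
  ext q; simp

theorem mdifferentiableAt_exp_two_mul (w : C^∞⟮I, M; ℝ⟯) (p : M) :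
    MDifferentiableAt I 𝓘(ℝ, ℝ) (fun q => Real.exp (2 * w q)) p := by
  rw [← exp_exponent_zero]
  exact mdifferentiableAt_exp_exponent w w 0 p

theorem mvfderiv_exp_two_mul (w : C^∞⟮I, M; ℝ⟯) {p : M} (x : TangentSpace I p) :
    mvfderiv I (fun q => Real.exp (2 * w q)) p x
      = Real.exp (2 * w p) * (2 * mvfderiv I w p x) := by
  rw [← exp_exponent_zero, mvfderiv_exp_exponent]
  simp

variable [IsManifold I ∞ M]

namespace ApcpcR

theorem exists_ne_zero_of_phi_eq {n : ℕ} (hn : 1 ≤ n) (S : ApcpcR n I M) {ε : ℝ}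
    (hε : ε * ε = 1) (p : M) :
    ∃ x : TangentSpace I p, x ≠ 0 ∧ S.phi p x = ε • x := by
  have h :
      finrank ℝ (End.eigenspace (S.phi p : TangentSpace I p →ₗ[ℝ] TangentSpace I p) ε) = n := by
    rcases mul_self_eq_one_iff.1 hε with rfl | rfl
    · exact S.finrank_eigenspace_one p
    · exact S.finrank_eigenspace_neg_one p
  have h0 : End.eigenspace (S.phi p : TangentSpace I p →ₗ[ℝ] TangentSpace I p) ε ≠ ⊥ := by
    intro h0
    rw [h0, finrank_bot] at h
    omega
  obtain ⟨x, hx, hx0⟩ := Submodule.exists_mem_ne_zero_of_ne_bot h0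
  exact ⟨x, hx0, End.mem_eigenspace_iff.1 hx⟩

end ApcpcR

variable [FiniteDimensional ℝ E]

namespace ApcpcR

variable {n : ℕ} {S : ApcpcR n I M} {p : M} {X Y Z : ∀ p : M, TangentSpace I p} {ε δ : ℝ}

theorem conformalInner_of_phi_eq (hε : ε * ε = 1) {x : TangentSpace I p}
    (hx : S.phi p x = ε • x) (a b c : ℝ) (y : TangentSpace I p) :
    S.conformalInner a b c p x y = Real.exp (2 * a + 2 * ε * b) * S.g.inner p x y := by
  rw [S.conformalInner_apply, ← S.g_phi_comm, hx, eta_eq_zero_of_phi_eq hε hx, map_smul,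
    smul_apply, smul_eq_mul, Real.exp_add, Real.cosh_eq, Real.sinh_eq]
  rcases mul_self_eq_one_iff.1 hε with rfl | rfl <;> ring_nf

theorem conformalInner_xi (a b c : ℝ) (y : TangentSpace I p) :
    S.conformalInner a b c p (S.xi p) y = Real.exp (2 * c) * S.g.inner p (S.xi p) y := by
  rw [S.conformalInner_apply, S.g.symm p (S.xi p), S.g.symm p (S.xi p), S.g_xi, S.g_xi, S.eta_phi,
    S.eta_xi]
  ring

variable (u v w : C^∞⟮I, M; ℝ⟯)

theorem IsEigenfieldAt.conformal_inner (hε : ε * ε = 1) (hX : S.IsEigenfieldAt ε X p) (q : M)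
    (y : TangentSpace I q) :
    (S.conformal u v w).g.inner q (X q) y
      = Real.exp (2 * u q + 2 * ε * v q) * S.g.inner q (X q) y :=
  conformalInner_of_phi_eq hε (hX.phi_eq q) _ _ _ y

variable (S) in
theorem conformal_inner_xi (q : M) (y : TangentSpace I q) :
    (S.conformal u v w).g.inner q (S.xi q) y = Real.exp (2 * w q) * S.g.inner q (S.xi q) y :=
  conformalInner_xi _ _ _ y

variable [T2Space M]

theorem IsParaSasakiLike.conformal_koszul (hS : S.IsParaSasakiLike) (hε : ε * ε = 1)
    (hδ : δ * δ = 1) (h : ε ≠ δ) (hX : S.IsEigenfieldAt ε X p) (hY : S.IsEigenfieldAt ε Y p)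
    (hZ : S.IsEigenfieldAt δ Z p) :
    koszul (S.conformal u v w).g X Y Z p
      = -(Real.exp (2 * u p + 2 * ε * v p) *
        (mvfderiv I u p (Z p) + ε * mvfderiv I v p (Z p)) * S.g.inner p (X p) (Y p)) := by
  have hk := koszul_of_proportional hX.diff hY.diff hZ.diff
    (mdifferentiableAt_exp_exponent u v ε p) (mdifferentiableAt_exp_exponent u v ε p)
    (mdifferentiableAt_exp_exponent u v δ p) (hX.conformal_inner u v w hε)
    (hY.conformal_inner u v w hε) (hZ.conformal_inner u v w hδ)
  obtain ⟨h1, h2⟩ := hS.eigenbundle_eqs hε hδ h hX hY hZ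
  rw [hY.mvfderiv_inner_eq_zero h hZ, hZ.mvfderiv_inner_eq_zero h.symm hX, h1,
    g_eq_zero_of_phi_eq h (hY.phi_eq p) (hZ.phi_eq p),
    g_eq_zero_of_phi_eq h.symm (hZ.phi_eq p) (hX.phi_eq p), mvfderiv_exp_exponent u v ε (Z p)] at hk
  linear_combination 1 / 2 * hk + 1 / 2 * Real.exp (2 * u p + 2 * ε * v p) * h2

theorem IsParaSasakiLike.conformal_koszul_xi_left (hS : S.IsParaSasakiLike) (hε : ε * ε = 1)
    (hδ : δ * δ = 1) (h : ε ≠ δ) (hY : S.IsEigenfieldAt ε Y p) (hZ : S.IsEigenfieldAt δ Z p) :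
    koszul (S.conformal u v w).g S.xi Y Z p = 0 := by
  have hε0 : ε ≠ 0 := fun h => by simp [h] at hε
  have hδ0 : δ ≠ 0 := fun h => by simp [h] at hδ
  have hξ := S.isEigenfieldAt_xi p
  have hk := koszul_of_proportional hξ.diff hY.diff hZ.diff
    (mdifferentiableAt_exp_two_mul w p) (mdifferentiableAt_exp_exponent u v ε p)
    (mdifferentiableAt_exp_exponent u v δ p) (S.conformal_inner_xi u v w)
    (hY.conformal_inner u v w hε) (hZ.conformal_inner u v w hδ)
  rw [hY.mvfderiv_inner_eq_zero h hZ, hZ.mvfderiv_inner_eq_zero hδ0 hξ,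
    hξ.mvfderiv_inner_eq_zero hε0.symm hY,
    g_eq_zero_of_phi_eq h (hY.phi_eq p) (hZ.phi_eq p),
    g_eq_zero_of_phi_eq hδ0 (hZ.phi_eq p) (hξ.phi_eq p),
    g_eq_zero_of_phi_eq hε0.symm (hξ.phi_eq p) (hY.phi_eq p),
    hS.inner_mlieBracket_xi hδ hε hZ hY, hS.inner_mlieBracket_xi_left hε hδ h hY hZ,
    VectorField.mlieBracket_swap_apply (V := Z), map_neg, neg_apply,
    hS.inner_mlieBracket_xi_left hδ hε h.symm hZ hY] at hk
  linear_combination 1 / 2 * hk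

theorem IsParaSasakiLike.conformal_koszul_xi_xi (hS : S.IsParaSasakiLike) (hε : ε * ε = 1)
    (hZ : S.IsEigenfieldAt ε Z p) :
    koszul (S.conformal u v w).g S.xi S.xi Z p
      = -(Real.exp (2 * w p) * mvfderiv I w p (Z p)) := by
  have hε0 : ε ≠ 0 := fun h => by simp [h] at hε
  have hξ := S.isEigenfieldAt_xi p
  have hk := koszul_of_proportional hξ.diff hξ.diff hZ.diff
    (mdifferentiableAt_exp_two_mul w p) (mdifferentiableAt_exp_two_mul w p)
    (mdifferentiableAt_exp_exponent u v ε p) (S.conformal_inner_xi u v w)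
    (S.conformal_inner_xi u v w) (hZ.conformal_inner u v w hε)
  rw [hξ.mvfderiv_inner_eq_zero hε0.symm hZ, hZ.mvfderiv_inner_eq_zero hε0 hξ,
    S.mvfderiv_inner_xi_xi, g_eq_zero_of_phi_eq hε0.symm (hξ.phi_eq p) (hZ.phi_eq p),
    g_eq_zero_of_phi_eq hε0 (hZ.phi_eq p) (hξ.phi_eq p), S.g_xi, S.eta_xi,
    hS.inner_mlieBracket_xi_right hε hZ, VectorField.mlieBracket_self,
    mvfderiv_exp_two_mul w (Z p)] at hk
  simp only [Pi.zero_apply, map_zero, zero_apply] at hk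
  linear_combination 1 / 2 * hk

theorem IsParaSasakiLike.conformal_koszul_xi_right (hS : S.IsParaSasakiLike) (hε : ε * ε = 1)
    (hX : S.IsEigenfieldAt ε X p) (hY : S.IsEigenfieldAt ε Y p) :
    koszul (S.conformal u v w).g X Y S.xi p
      = -(Real.exp (2 * u p + 2 * ε * v p) *
        (mvfderiv I u p (S.xi p) + ε * mvfderiv I v p (S.xi p) + ε)
          * S.g.inner p (X p) (Y p)) := by
  have hε0 : ε ≠ 0 := fun h => by simp [h] at hε
  have hξ := S.isEigenfieldAt_xi p
  have hk := koszul_of_proportional hX.diff hY.diff hξ.diff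
    (mdifferentiableAt_exp_exponent u v ε p) (mdifferentiableAt_exp_exponent u v ε p)
    (mdifferentiableAt_exp_two_mul w p) (hX.conformal_inner u v w hε)
    (hY.conformal_inner u v w hε) (S.conformal_inner_xi u v w)
  have h2 := hS.lieDerivative_xi hε hε hX hY
  rw [hY.mvfderiv_inner_eq_zero hε0 hξ, hξ.mvfderiv_inner_eq_zero hε0.symm hX,
    hS.inner_mlieBracket_xi hε hε hX hY,
    g_eq_zero_of_phi_eq hε0 (hY.phi_eq p) (hξ.phi_eq p),
    g_eq_zero_of_phi_eq hε0.symm (hξ.phi_eq p) (hX.phi_eq p),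
    mvfderiv_exp_exponent u v ε (S.xi p)] at hk
  linear_combination 1 / 2 * hk + 1 / 2 * Real.exp (2 * u p + 2 * ε * v p) * h2

theorem IsParaSasakiLike.conformal_koszul_xi_right_of_ne (hS : S.IsParaSasakiLike)
    (hε : ε * ε = 1) (hδ : δ * δ = 1) (h : ε ≠ δ)
    (hX : S.IsEigenfieldAt ε X p) (hY : S.IsEigenfieldAt δ Y p) :
    koszul (S.conformal u v w).g X Y S.xi p = 0 := by
  have hε0 : ε ≠ 0 := fun h => by simp [h] at hε
  have hδ0 : δ ≠ 0 := fun h => by simp [h] at hδ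
  have hξ := S.isEigenfieldAt_xi p
  have hk := koszul_of_proportional hX.diff hY.diff hξ.diff
    (mdifferentiableAt_exp_exponent u v ε p) (mdifferentiableAt_exp_exponent u v δ p)
    (mdifferentiableAt_exp_two_mul w p) (hX.conformal_inner u v w hε)
    (hY.conformal_inner u v w hδ) (S.conformal_inner_xi u v w)
  rw [hY.mvfderiv_inner_eq_zero hδ0 hξ, hξ.mvfderiv_inner_eq_zero hε0.symm hX,
    hX.mvfderiv_inner_eq_zero h hY, g_eq_zero_of_phi_eq h (hX.phi_eq p) (hY.phi_eq p),
    hS.inner_mlieBracket_xi hε hδ hX hY,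
    g_eq_zero_of_phi_eq hδ0 (hY.phi_eq p) (hξ.phi_eq p),
    g_eq_zero_of_phi_eq hε0.symm (hξ.phi_eq p) (hX.phi_eq p),
    hS.inner_mlieBracket_xi_left hε hδ h hX hY,
    hS.inner_mlieBracket_xi_left hδ hε h.symm hY hX] at hk
  linear_combination 1 / 2 * hk

/-- The conformal structure is para-Sasaki-like iff `u + ε v` is constant along the eigenspace of
`φ` for `-ε`, `w` is constant along `ker η`, and `ε du(ξ) + dv(ξ) = e ^ w - 1`; the two values of
`ε` together give `du(ξ) = 0` and `dv(ξ) = e ^ w - 1`. -/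
theorem IsParaSasakiLike.conformal_iff (hS : S.IsParaSasakiLike) (hn : 1 ≤ n) :
    (S.conformal u v w).IsParaSasakiLike ↔ ∀ (p : M) (ε : ℝ), ε * ε = 1 →
      (∀ z, S.phi p z = -ε • z → mvfderiv I u p z + ε * mvfderiv I v p z = 0) ∧
      (∀ z, S.phi p z = ε • z → mvfderiv I w p z = 0) ∧
      ε * mvfderiv I u p (S.xi p) + mvfderiv I v p (S.xi p) = Real.exp (w p) - 1 := by
  have hc (p : M) : Real.exp (-w p) * Real.exp (w p) = 1 := by rw [← Real.exp_add]; simp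
  rw [(S.conformal u v w).isParaSasakiLike_iff_koszul (c := fun p => Real.exp (-w p)) (Ξ := S.xi)
    (fun p => (Real.exp_pos _).ne') S.smooth_xi (fun p => rfl)]
  constructor
  · intro h p ε hε
    -- a nonzero eigenvector exists since `n ≥ 1`; it cancels the factor `g(X, X)`
    obtain ⟨x, hx0, hx⟩ := exists_ne_zero_of_phi_eq hn S hε p
    obtain ⟨X, hX, rfl⟩ := S.exists_isEigenfieldAt hε hx
    have hpos := (mul_pos (Real.exp_pos (2 * u p + 2 * ε * v p)) (S.g.pos p _ hx0)).ne'
    have hX' : (S.conformal u v w).IsEigenfieldAt ε X p := ⟨hX.diff, hX.phi_eq⟩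
    refine ⟨fun z hz => ?_, fun z hz => ?_, ?_⟩
    · have hε' : -ε * -ε = 1 := by linarith
      have hne : ε ≠ -ε := by
        intro h0
        have : ε = 0 := by linarith
        simp [this] at hε
      obtain ⟨Z, hZ, rfl⟩ := S.exists_isEigenfieldAt hε' hz
      have h1 := (h p ε ε (-ε) hε hε hε' X X Z hX' hX' ⟨hZ.diff, hZ.phi_eq⟩).1
      replace h1 := (mul_eq_zero.1 h1).resolve_left (sub_ne_zero.2 hne)
      rw [hS.conformal_koszul u v w hε hε' hne hX hX hZ] at h1
      refine (mul_eq_zero.1 ?_).resolve_left hpos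
      linear_combination -h1
    · obtain ⟨Z, hZ, rfl⟩ := S.exists_isEigenfieldAt hε hz
      have h1 := (h p ε ε ε hε hε hε X X Z hX' hX' ⟨hZ.diff, hZ.phi_eq⟩).2.2.1
      rw [hS.conformal_koszul_xi_xi u v w hε hZ, neg_eq_zero] at h1
      exact (mul_eq_zero.1 h1).resolve_left (Real.exp_pos _).ne'
    · have h1 := (h p ε ε ε hε hε hε X X X hX' hX' hX').2.2.2
      rw [hS.conformal_koszul_xi_right u v w hε hX hX, hX.conformal_inner u v w hε] at h1
      refine sub_eq_zero.1 ((mul_eq_zero.1 ?_).resolve_left hpos)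
      set f := Real.exp (2 * u p + 2 * ε * v p)
      set G := S.g.inner p (X p) (X p)
      set a := mvfderiv I u p (S.xi p)
      set b := mvfderiv I v p (S.xi p)
      linear_combination -Real.exp (w p) * h1 - f * G * (ε * a + ε * ε * b + ε * ε) * hc p
        - f * G * (b + 1) * hε
  · intro h p ε δ ζ hε hδ hζ X Y Z hX hY hZ
    replace hX : S.IsEigenfieldAt ε X p := ⟨hX.diff, hX.phi_eq⟩
    replace hY : S.IsEigenfieldAt δ Y p := ⟨hY.diff, hY.phi_eq⟩
    replace hZ : S.IsEigenfieldAt ζ Z p := ⟨hZ.diff, hZ.phi_eq⟩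
    have hneg {a b : ℝ} (ha : a * a = 1) (hb : b * b = 1) (hab : a ≠ b) : b = -a := by
      rcases mul_self_eq_mul_self_iff.1 (hb.trans ha.symm) with h | h
      · exact absurd h.symm hab
      · exact h
    refine ⟨?_, ?_, ?_, ?_⟩
    · by_cases hδζ : δ = ζ
      · simp [hδζ]
      refine mul_eq_zero_of_right _ ?_
      by_cases hεδ : ε = δ
      · subst hεδ
        have hz := (h p ε hε).1 (Z p) (by rw [hZ.phi_eq, hneg hε hζ hδζ])
        rw [hS.conformal_koszul u v w hε hζ hδζ hX hY hZ, hz]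
        simp
      · -- here `ε = ζ`; the metric compatibility exchanges `Y` and `Z`
        have hεζ : ε = ζ := by rw [hneg hδ hε (Ne.symm hεδ), hneg hδ hζ hδζ]
        subst hεζ
        have hy := (h p ε hε).1 (Y p) (by rw [hY.phi_eq, hneg hε hδ hεδ])
        have h1 := koszul_add_koszul_swap (S.conformal u v w).g X Y Z p
        have e : (fun q => (S.conformal u v w).g.inner q (Y q) (Z q)) = fun _ => 0 := by
          ext q
          rw [hY.conformal_inner u v w hδ, g_eq_zero_of_phi_eq hδζ (hY.phi_eq q) (hZ.phi_eq q),
            mul_zero]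
        rw [hS.conformal_koszul u v w hε hδ hεδ hX hZ hY, hy, e, mvfderiv_const] at h1
        simpa using h1
    · by_cases hδζ : δ = ζ
      · simp [hδζ]
      · rw [hS.conformal_koszul_xi_left u v w hδ hζ hδζ hY hZ, mul_zero]
    · rw [hS.conformal_koszul_xi_xi u v w hζ hZ, (h p ζ hζ).2.1 _ (hZ.phi_eq p)]
      simp
    · rw [hX.conformal_inner u v w hε]
      by_cases hεδ : ε = δ
      · subst hεδ
        have h1 := (h p ε hε).2.2
        rw [hS.conformal_koszul_xi_right u v w hε hX hY]
        set f := Real.exp (2 * u p + 2 * ε * v p)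
        set G := S.g.inner p (X p) (Y p)
        set a := mvfderiv I u p (S.xi p)
        set b := mvfderiv I v p (S.xi p)
        linear_combination -Real.exp (-w p) * f * G * h1 - f * G * hc p
          - Real.exp (-w p) * f * G * (b + 1) * hε
      · rw [hS.conformal_koszul_xi_right_of_ne u v w hε hδ hεδ hX hY,
          g_eq_zero_of_phi_eq hεδ (hX.phi_eq p) (hY.phi_eq p)]
        simp

end ApcpcR

end ConformalChange

/-! ### The characterization by differential equations -/

section Characterization

variable {E : Type*} [NormedAddCommGroup E] [NormedSpace ℝ E] [FiniteDimensional ℝ E]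
  {H : Type*} [TopologicalSpace H] {I : ModelWithCorners ℝ E H}
  {M : Type*} [TopologicalSpace M] [T2Space M] [ChartedSpace H M] [IsManifold I ∞ M]

namespace ApcpcR

variable {n : ℕ} {S : ApcpcR n I M}

theorem IsParaSasakiLike.conformal_iff_mvfderiv (hS : S.IsParaSasakiLike) (hn : 1 ≤ n)
    (u v w : C^∞⟮I, M; ℝ⟯) :
    (S.conformal u v w).IsParaSasakiLike ↔ ∀ p : M,
      (mvfderiv I w p).comp (S.phi p) = 0 ∧
      mvfderiv I u p - (mvfderiv I v p).comp (S.phi p) = 0 ∧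
      (mvfderiv I u p).comp (S.phi p) - mvfderiv I v p = (1 - Real.exp (w p)) • S.eta p := by
  rw [hS.conformal_iff u v w hn]
  have h1 : (1 : ℝ) * 1 = 1 := by norm_num
  have h2 : (-1 : ℝ) * -1 = 1 := by norm_num
  refine forall_congr' fun p => ⟨fun h => ?_, fun ⟨hw, huv, hvu⟩ ε hε => ?_⟩
  · obtain ⟨a1, b1, c1⟩ := h 1 h1
    obtain ⟨a2, b2, c2⟩ := h (-1) h2
    -- split a tangent vector along `ξ` and the two eigenspaces of `φ` on `ker η`
    have hdec (x : TangentSpace I p) : ∃ y z, x = S.eta p x • S.xi p + y + z ∧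
        S.phi p x = y - z ∧ S.phi p y = (1 : ℝ) • y ∧ S.phi p z = (-1 : ℝ) • z := by
      obtain ⟨y, z, hyz, hy, hz⟩ := S.exists_eq_add_of_eta_eq_zero (S.eta_phi p (S.phi p x))
      refine ⟨y, z, ?_, ?_, hy, hz⟩
      · rw [add_assoc, ← hyz, S.phi_phi]
        abel
      · rw [← phi_phi_phi, hyz, map_add, hy, hz]
        module
    refine ⟨?_, ?_, ?_⟩ <;> ext x <;> obtain ⟨y, z, hx, hφ, hy, hz⟩ := hdec x <;>
      have hy1 := a2 y (by rw [hy]; simp) <;> have hz1 := a1 z hz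
    · rw [ContinuousLinearMap.comp_apply, hφ, map_sub, b1 y hy, b2 z hz, sub_zero]
      rfl
    · have hu := congrArg (mvfderiv I u p) hx
      rw [map_add, map_add, map_smul, smul_eq_mul] at hu
      rw [sub_apply, ContinuousLinearMap.comp_apply, hφ, map_sub, zero_apply]
      linear_combination hu + 1 / 2 * S.eta p x * (c1 - c2) + hy1 + hz1
    · have hv := congrArg (mvfderiv I v p) hx
      rw [map_add, map_add, map_smul, smul_eq_mul] at hv
      rw [sub_apply, ContinuousLinearMap.comp_apply, smul_apply, smul_eq_mul, hφ, map_sub]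
      linear_combination -hv - 1 / 2 * S.eta p x * (c1 + c2) + hy1 - hz1
  · have hw' (x : TangentSpace I p) : mvfderiv I w p (S.phi p x) = 0 := congr($hw x)
    have huv' (x : TangentSpace I p) : mvfderiv I u p x - mvfderiv I v p (S.phi p x) = 0 :=
      congr($huv x)
    have hvu' : mvfderiv I u p (S.phi p (S.xi p)) - mvfderiv I v p (S.xi p)
      = (1 - Real.exp (w p)) * S.eta p (S.xi p) := congr($hvu (S.xi p))
    have hε0 : ε ≠ 0 := fun h => by simp [h] at hε
    refine ⟨fun z hz => ?_, fun z hz => ?_, ?_⟩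
    · have := huv' z
      rw [hz, map_smul, smul_eq_mul] at this
      linarith
    · have := hw' z
      rw [hz, map_smul, smul_eq_mul] at this
      exact (mul_eq_zero.1 this).resolve_left hε0
    · have := huv' (S.xi p)
      rw [S.phi_xi, map_zero] at this hvu'
      rw [S.eta_xi] at hvu'
      linear_combination ε * this - hvu'

/-- For `w = 0` the conditions on `u` and `v` say that both are constant along `ξ` and that
`du = dv ∘ φ` on `ker η`. -/
theorem IsParaSasakiLike.conformal_iff_of_eq_zero (hS : S.IsParaSasakiLike) (hn : 1 ≤ n)
    (u v : C^∞⟮I, M; ℝ⟯) {w : C^∞⟮I, M; ℝ⟯} (hw : ∀ p, w p = 0) :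
    (S.conformal u v w).IsParaSasakiLike ↔
      (∀ p, mvfderiv I u p (S.xi p) = 0 ∧ mvfderiv I v p (S.xi p) = 0) ∧
      ∀ p x, S.eta p x = 0 → mvfderiv I u p x = mvfderiv I v p (S.phi p x) := by
  rw [hS.conformal_iff_mvfderiv hn, ← forall_and]
  refine forall_congr' fun p => ⟨fun ⟨_, huv, hvu⟩ => ?_, fun ⟨⟨hu, hv⟩, h⟩ => ?_⟩
  · have huv' (x : TangentSpace I p) : mvfderiv I u p x - mvfderiv I v p (S.phi p x) = 0 :=
      congr($huv x)
    have hvu' : mvfderiv I u p (S.phi p (S.xi p)) - mvfderiv I v p (S.xi p)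
      = (1 - Real.exp (w p)) * S.eta p (S.xi p) := congr($hvu (S.xi p))
    have h1 := huv' (S.xi p)
    rw [S.phi_xi, map_zero] at h1 hvu'
    rw [hw, Real.exp_zero] at hvu'
    exact ⟨⟨by linarith, by linarith⟩, fun x _ => sub_eq_zero.1 (huv' x)⟩
  · have hw' : (w : M → ℝ) = fun _ => 0 := funext hw
    refine ⟨by rw [hw', mvfderiv_const]; ext x; simp, ?_, ?_⟩ <;> ext x
    · have h1 := h (S.phi p (S.phi p x)) (S.eta_phi p _)
      rw [phi_phi_phi, S.phi_phi, map_sub, map_smul, hu] at h1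
      rw [sub_apply, ContinuousLinearMap.comp_apply, ← h1]
      simp
    · have h1 := h (S.phi p x) (S.eta_phi p _)
      rw [S.phi_phi, map_sub, map_smul, hv] at h1
      rw [sub_apply, ContinuousLinearMap.comp_apply, h1, hw]
      simp

end ApcpcR

end Characterization

/-! ### Restriction to integral submanifolds -/

section RestrictionToLeaves

theorem paraUnit_mul (z : Paracomplex) : paraUnit * z = ⟨z.im, z.re⟩ := by
  ext <;> simp

theorem paraFun_re {N : Type*} (u v : N → ℝ) (x : N) : (paraFun u v x).re = u x := by
  simp [paraFun]

theorem paraFun_im {N : Type*} (u v : N → ℝ) (x : N) : (paraFun u v x).im = v x := by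
  simp [paraFun]

variable {E : Type*} [NormedAddCommGroup E] [NormedSpace ℝ E]
  {H : Type*} [TopologicalSpace H] {I : ModelWithCorners ℝ E H}
  {M : Type*} [TopologicalSpace M] [ChartedSpace H M] [IsManifold I ∞ M]
  {E' : Type*} [NormedAddCommGroup E'] [NormedSpace ℝ E']
  {H' : Type*} [TopologicalSpace H'] {J : ModelWithCorners ℝ E' H'}
  {N : Type*} [TopologicalSpace N] [ChartedSpace H' N]

namespace ApcpcR

variable {n : ℕ} {S : ApcpcR n I M} {i : N → M}
  {P : ∀ x : N, TangentSpace J x →L[ℝ] TangentSpace J x}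

theorem IsLeaf.mvfderiv_comp (hi : S.IsLeaf J i P) (f : C^∞⟮I, M; ℝ⟯) (x : N)
    (X : TangentSpace J x) :
    mvfderiv J (fun y => f (i y)) x X = mvfderiv I f (i x) (mfderiv J I i x X) :=
  mvfderiv_comp_apply x (mdifferentiableAt_contMDiffMap f (i x))
    ((hi.smooth x).mdifferentiableAt (by simp)) X

/-- A function that is constant along `ξ` does not depend on the time in a local splitting. -/
theorem IsSplitting.apply_eq_apply {a b : ℝ} {Φ : ℝ × N → M} (hΦ : S.IsSplitting J a b Φ P)
    {f : C^∞⟮I, M; ℝ⟯} (hf : ∀ p, mvfderiv I f p (S.xi p) = 0) {s t : ℝ} (hs : s ∈ Ioo a b)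
    (ht : t ∈ Ioo a b) (x : N) : f (Φ (s, x)) = f (Φ (t, x)) := by
  have hd (r : ℝ) (hr : r ∈ Ioo a b) : HasDerivAt (fun r => f (Φ (r, x))) 0 r := by
    have hsm : MDifferentiableAt (𝓘(ℝ, ℝ).prod J) I Φ (r, x) :=
      ((hΦ.smooth (r, x) ⟨hr, mem_univ x⟩).contMDiffAt
        ((isOpen_Ioo.prod isOpen_univ).mem_nhds ⟨hr, mem_univ x⟩)).mdifferentiableAt (by simp)
    have hpair : MDifferentiableAt 𝓘(ℝ, ℝ) (𝓘(ℝ, ℝ).prod J) (fun r : ℝ => (r, x)) r :=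
      mdifferentiableAt_id.prodMk mdifferentiableAt_const
    have hcurve : MDifferentiableAt 𝓘(ℝ, ℝ) I (fun r : ℝ => Φ (r, x)) r :=
      MDifferentiableAt.comp r hsm hpair
    have hf' := mdifferentiableAt_contMDiffMap f (Φ (r, x))
    have h1 := mvfderiv_comp_apply (f := fun r : ℝ => Φ (r, x)) r hf' hcurve (1 : ℝ)
    rw [hΦ.deriv_t r hr x, hf] at h1
    have h2 : DifferentiableAt ℝ (fun r => f (Φ (r, x))) r :=
      (MDifferentiableAt.comp r hf' hcurve).differentiableAt
    have h3 := h2.hasDerivAt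
    have h4 : deriv (fun r => f (Φ (r, x))) r = 0 := by
      rw [← h1, ← fderiv_apply_one_eq_deriv, ← mfderiv_eq_fderiv]
      rfl
    rwa [h4] at h3
  refine (convex_Ioo a b).is_const_of_fderivWithin_eq_zero (𝕜 := ℝ) (f := fun r => f (Φ (r, x)))
    (fun r hr => (hd r hr).differentiableAt.differentiableWithinAt) (fun r hr => ?_) hs ht
  rw [fderivWithin_of_isOpen isOpen_Ioo hr]
  ext
  simp [(hd r hr).deriv]

variable [FiniteDimensional ℝ E]

/-- The restriction of `u + e v` to a leaf is paraholomorphic iff `du = dv ∘ φ` on `ker η` at the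
points of the leaf. -/
theorem IsLeaf.isParaholomorphic_iff (hi : S.IsLeaf J i P) (u v : C^∞⟮I, M; ℝ⟯) :
    IsParaholomorphic J P (paraFun (fun x => u (i x)) fun x => v (i x)) ↔
      ∀ (x : N) (y : TangentSpace I (i x)), S.eta (i x) y = 0 →
        mvfderiv I u (i x) y = mvfderiv I v (i x) (S.phi (i x) y) := by
  have key (x : N) (X : TangentSpace J x) :
      paraDeriv J (paraFun (fun x => u (i x)) fun x => v (i x)) x X
        = ⟨mvfderiv I u (i x) (mfderiv J I i x X), mvfderiv I v (i x) (mfderiv J I i x X)⟩ := by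
    simp only [paraDeriv, paraFun_re, paraFun_im, hi.mvfderiv_comp]
  constructor
  · intro h x y hy
    obtain ⟨X, rfl⟩ := (hi.range_eq x y).1 hy
    have := h.deriv_comp x X
    rw [key, key, paraUnit_mul, hi.phi_comp] at this
    exact (congrArg QuadraticAlgebra.im this).symm
  · intro h
    refine ⟨?_, ?_, fun x X => ?_⟩
    · simp only [paraFun_re]
      exact u.contMDiff.comp hi.smooth
    · simp only [paraFun_im]
      exact v.contMDiff.comp hi.smooth
    · have hX : S.eta (i x) (mfderiv J I i x X) = 0 := (hi.range_eq x _).2 ⟨X, rfl⟩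
      have h1 := h x _ hX
      have h2 := h x _ (S.eta_phi (i x) (mfderiv J I i x X))
      rw [S.phi_phi, hX, zero_smul, sub_zero] at h2
      rw [key, key, paraUnit_mul, hi.phi_comp, h1, h2]

end ApcpcR

end RestrictionToLeaves

/-! ### Hypersurfaces tangent to the kernel of a closed 1-form -/

section LocalIntegralManifold

open Topology in
/-- Integral manifolds of a closed `1`-form `α` on an open subset of a vector space: by the
Poincaré lemma `α = df` near `x₀`; the inverse function theorem straightens `f` to a coordinate, and
the level set of `f` through `x₀` is parametrized by the other coordinates. -/
theorem exists_integral_parametrization {E F : Type*} [NormedAddCommGroup E] [NormedSpace ℝ E]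
    [FiniteDimensional ℝ E] [NormedAddCommGroup F] [NormedSpace ℝ F] [FiniteDimensional ℝ F]
    (hdim : finrank ℝ E = finrank ℝ F + 1) {U : Set E} (hU : IsOpen U) {x₀ : E} (hx₀ : x₀ ∈ U)
    {α : E → E →L[ℝ] ℝ} (hα : ContDiffOn ℝ ∞ α U)
    (hsymm : ∀ x ∈ U, ∀ a b, fderiv ℝ α x a b = fderiv ℝ α x b a) (h0 : α x₀ ≠ 0) :
    ∃ (V : Set F) (y₀ : F) (j : F → E), IsOpen V ∧ y₀ ∈ V ∧ j y₀ = x₀ ∧ ContDiffOn ℝ ∞ j V ∧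
      ∀ y ∈ V, j y ∈ U ∧ Function.Injective (fderiv ℝ j y) ∧
        ∀ a, α (j y) a = 0 ↔ ∃ b, fderiv ℝ j y b = a := by
  -- a primitive `f` of `α` on a ball
  obtain ⟨r, hr, hrU⟩ := Metric.isOpen_iff.1 hU x₀ hx₀
  set B := Metric.ball x₀ r
  have hB : IsOpen B := Metric.isOpen_ball
  have hx₀B : x₀ ∈ B := Metric.mem_ball_self hr
  have hαB := hα.mono hrU
  obtain ⟨f, hf⟩ := (convex_ball x₀ r).exists_forall_hasFDerivAt_of_fderiv_symmetric hB
    (hαB.differentiableOn (by simp)) fun a ha => hsymm a (hrU ha)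
  have hfsm : ContDiffOn ℝ ∞ f B := by
    rw [contDiffOn_infty_iff_fderiv_of_isOpen hB]
    exact ⟨fun x hx => (hf x hx).differentiableAt.differentiableWithinAt,
      hαB.congr fun x hx => (hf x hx).fderiv⟩
  -- linear coordinates `σ` on the kernel of `α x₀`
  have hker : finrank ℝ (LinearMap.ker (α x₀ : E →ₗ[ℝ] ℝ)) = finrank ℝ F := by
    have h1 := LinearMap.finrank_range_add_finrank_ker (α x₀ : E →ₗ[ℝ] ℝ)
    have h2 : LinearMap.range (α x₀ : E →ₗ[ℝ] ℝ) = ⊤ := by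
      refine LinearMap.range_eq_top.2 (LinearMap.surjective fun h => h0 ?_)
      ext x
      exact LinearMap.congr_fun h x
    rw [h2, finrank_top, finrank_self, hdim] at h1
    omega
  obtain ⟨σ', hσ'⟩ := LinearMap.exists_extend
    (LinearEquiv.ofFinrankEq (LinearMap.ker (α x₀ : E →ₗ[ℝ] ℝ)) F hker).toLinearMap
  set σ : E →L[ℝ] F := LinearMap.toContinuousLinearMap σ'
  have hσ : ∀ x, α x₀ x = 0 → σ x = 0 → x = 0 := by
    intro x hx hx'
    have h1 := LinearMap.congr_fun hσ' ⟨x, hx⟩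
    have h2 : LinearEquiv.ofFinrankEq (LinearMap.ker (α x₀ : E →ₗ[ℝ] ℝ)) F hker ⟨x, hx⟩ = 0 :=
      h1.symm.trans hx'
    exact congrArg Subtype.val ((LinearEquiv.map_eq_zero_iff _).1 h2)
  have hinj : Function.Injective ((α x₀).prod σ : E →ₗ[ℝ] ℝ × F) := by
    rw [← LinearMap.ker_eq_bot, LinearMap.ker_eq_bot']
    intro x hx
    exact hσ x (congrArg Prod.fst hx) (congrArg Prod.snd hx)
  have hdim' : finrank ℝ E = finrank ℝ (ℝ × F) := by
    rw [finrank_prod, finrank_self, hdim, add_comm]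
  let Θ : E ≃L[ℝ] ℝ × F :=
    (LinearEquiv.ofInjectiveOfFinrankEq _ hinj hdim').toContinuousLinearEquiv
  have hΘ : (Θ : E →L[ℝ] ℝ × F) = (α x₀).prod σ := by
    ext x <;> rfl
  -- the straightening map
  set Ψ : E → ℝ × F := fun x => (f x - f x₀, σ x)
  have hΨ (x) (hx : x ∈ B) : HasFDerivAt Ψ ((α x).prod σ) x :=
    ((hf x hx).sub_const _).prodMk σ.hasFDerivAt
  have hΨsm : ContDiffOn ℝ ∞ Ψ B := (hfsm.sub contDiffOn_const).prodMk σ.contDiff.contDiffOn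
  have hΨ₀ : HasFDerivAt Ψ (Θ : E →L[ℝ] ℝ × F) x₀ := by rw [hΘ]; exact hΨ x₀ hx₀B
  have hΨsm₀ : ContDiffAt ℝ ∞ Ψ x₀ := hΨsm.contDiffAt (hB.mem_nhds hx₀B)
  set G := hΨsm₀.toOpenPartialHomeomorph Ψ hΨ₀ (by simp)
  have hGcoe : (G : E → ℝ × F) = Ψ := hΨsm₀.toOpenPartialHomeomorph_coe hΨ₀ (by simp)
  have hGx₀ : x₀ ∈ G.source := hΨsm₀.mem_toOpenPartialHomeomorph_source hΨ₀ (by simp)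
  -- the derivative stays invertible near `x₀`
  have hev : ∀ᶠ x in 𝓝 x₀, x ∈ B ∧ ∃ e : E ≃L[ℝ] ℝ × F, (e : E →L[ℝ] ℝ × F) = (α x).prod σ := by
    have hcont : ContinuousAt (fun x => (α x).prod σ) x₀ := by
      have : ContinuousAt α x₀ := hα.continuousOn.continuousAt (hU.mem_nhds hx₀)
      exact ((ContinuousLinearMap.prodₗᵢ ℝ).continuous.continuousAt.comp
        (this.prodMk continuousAt_const))
    have hrange : range ((↑) : (E ≃L[ℝ] ℝ × F) → E →L[ℝ] ℝ × F) ∈ 𝓝 ((α x₀).prod σ) := by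
      rw [← hΘ]
      exact Θ.nhds
    exact (hB.eventually_mem hx₀B).and (hcont hrange)
  obtain ⟨W, hW, hWo, hx₀W⟩ := mem_nhds_iff.1 hev
  refine ⟨{y | ((0 : ℝ), y) ∈ G.target ∩ G.symm ⁻¹' W}, σ x₀, fun y => G.symm (0, y), ?_, ?_, ?_,
    ?_, ?_⟩
  · exact (G.isOpen_inter_preimage_symm hWo).preimage (by fun_prop)
  · have h1 : ((0 : ℝ), σ x₀) = G x₀ := by rw [hGcoe]; simp [Ψ]
    refine ⟨?_, ?_⟩
    · rw [h1]; exact G.map_source hGx₀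
    · rw [mem_preimage, h1, G.left_inv hGx₀]; exact hx₀W
  · have h1 : ((0 : ℝ), σ x₀) = G x₀ := by rw [hGcoe]; simp [Ψ]
    simp only [h1, G.left_inv hGx₀]
  · intro y hy
    obtain ⟨hxB, e, he⟩ := hW hy.2
    have h1 : HasFDerivAt G (e : E →L[ℝ] ℝ × F) (G.symm (0, y)) := by
      rw [hGcoe, he]; exact hΨ _ hxB
    have h2 : ContDiffAt ℝ ∞ G (G.symm (0, y)) := by
      rw [hGcoe]; exact hΨsm.contDiffAt (hB.mem_nhds hxB)
    have h3 : ContDiffAt ℝ ∞ (fun y : F => ((0 : ℝ), y)) y := by fun_prop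
    exact ((G.contDiffAt_symm hy.1 h1 h2).comp y h3).contDiffWithinAt
  · intro y hy
    obtain ⟨hxB, e, he⟩ := hW hy.2
    have h1 : HasFDerivAt G (e : E →L[ℝ] ℝ × F) (G.symm (0, y)) := by
      rw [hGcoe, he]; exact hΨ _ hxB
    have h2 := (G.hasFDerivAt_symm hy.1 h1).comp y (hasFDerivAt_prodMk_right (𝕜 := ℝ) (0 : ℝ) y)
    have h3 (b : F) : fderiv ℝ (fun y => G.symm ((0 : ℝ), y)) y b = e.symm (0, b) :=
      congrArg (fun L => L b) h2.fderiv
    have h4 (a : E) : e a = (α (G.symm (0, y)) a, σ a) := congrArg (fun L => L a) he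
    refine ⟨hrU hxB, fun b b' hb => ?_, fun a => ⟨fun ha => ⟨σ a, ?_⟩, ?_⟩⟩
    · rw [h3, h3] at hb
      exact congrArg Prod.snd (e.symm.injective hb)
    · rw [h3, ← ha, ← h4, e.symm_apply_apply]
    · rintro ⟨b, rfl⟩
      have := h4 (e.symm (0, b))
      rw [e.apply_symm_apply] at this
      rw [h3]
      exact (congrArg Prod.fst this).symm

end LocalIntegralManifold

/-! ### Closedness of the contact form -/

section Closedness

variable {E : Type*} [NormedAddCommGroup E] [NormedSpace ℝ E] [FiniteDimensional ℝ E]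
  {H : Type*} [TopologicalSpace H] {I : ModelWithCorners ℝ E H}
  {M : Type*} [TopologicalSpace M] [ChartedSpace H M] [IsManifold I ∞ M]

namespace ApcpcR

variable {n : ℕ} {S : ApcpcR n I M} {p : M}

variable (S) in
theorem structureTensor_swap (x y z : TangentSpace I p) :
    S.structureTensor p x y z = S.structureTensor p x z y := by
  have hx := mdifferentiableAt_extend I E x
  have hy := mdifferentiableAt_extend I E y
  have hz := mdifferentiableAt_extend I E z
  rw [structureTensor, structureTensor, S.F_eq_koszul hx hy hz, S.F_eq_koszul hx hz hy]
  set X := extend E x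
  set Y := extend E y
  set Z := extend E z
  have h1 := koszul_add_koszul_swap S.g X (fun q => S.phi q (Y q)) Z p
  have h2 := koszul_add_koszul_swap S.g X Y (fun q => S.phi q (Z q)) p
  have e : (fun q => S.g.inner q (S.phi q (Y q)) (Z q))
      = fun q => S.g.inner q (Y q) (S.phi q (Z q)) := funext fun q => S.g_phi_comm q _ _
  rw [e] at h1
  linear_combination h1 - h2

/-- `g(∇_X ξ, Y) = g(X, φ Y)`; in other words `∇ξ = φ`. -/
theorem IsParaSasakiLike.koszul_xi [T2Space M] (hS : S.IsParaSasakiLike)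
    {X Y : ∀ p : M, TangentSpace I p} (hX : IsDiffFieldAt I X p) (hY : IsDiffFieldAt I Y p) :
    koszul S.g X S.xi Y p = S.g.inner p (X p) (S.phi p (Y p)) := by
  have hξ := S.smooth_xi.isDiffFieldAt p
  have hφY := S.isDiffFieldAt_phi hY
  have hφφY := S.isDiffFieldAt_phi hφY
  have hc : MDifferentiableAt I 𝓘(ℝ, ℝ) (fun _ : M => S.eta p (Y p)) p := mdifferentiableAt_const
  have hten := koszul_tensorial S.g hX hξ
  -- split `Y p = φ (φ Y) + η(Y) ξ`
  have h1 : koszul S.g X S.xi Y p = koszul S.g X S.xi (fun q => S.phi q (S.phi q (Y q))) p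
      + S.eta p (Y p) * koszul S.g X S.xi S.xi p := by
    have h := hten.pointwise hY (mdifferentiableAt_add_section hφφY (hc.smul_section hξ))
      (by simp [S.phi_phi])
    rw [h, hten.add hφφY (hc.smul_section hξ), hten.smul hc hξ, smul_eq_mul]
  have h2 : koszul S.g X S.xi S.xi p = 0 := by
    have h := koszul_add_koszul_swap S.g X S.xi S.xi p
    rw [S.mvfderiv_inner_xi_xi] at h
    linarith
  have h3 : S.F X S.xi (fun q => S.phi q (Y q)) p
      = -koszul S.g X S.xi (fun q => S.phi q (S.phi q (Y q))) p := by
    have e : (fun q => S.phi q (S.xi q)) = (fun _ : M => (0 : ℝ)) • S.xi := by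
      ext q; simp [S.phi_xi]
    have h := koszul_smul_middle S.g (f := fun _ : M => (0 : ℝ)) mdifferentiableAt_const hX hξ hφY
    rw [S.F_eq_koszul hX hξ hφY, e, h, mvfderiv_const]
    simp
  have hη := S.eta_phi p (Y p)
  -- split `X p = φ (φ X) + η(X) ξ`
  have h4 : S.structureTensor p (X p) (S.xi p) (S.phi p (Y p))
      = -S.g.inner p (X p) (S.phi p (Y p)) := by
    have hX' : X p = S.phi p (S.phi p (X p)) + S.eta p (X p) • S.xi p := by simp [S.phi_phi]
    have hη' := S.eta_phi p (S.phi p (X p))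
    have ha := S.isParaSasakiLike_iff_structureTensor.1 hS p _ _ _ hη' hη hη
    have hb : S.g.inner p (S.xi p) (S.phi p (Y p)) = 0 := by rw [S.g.symm, S.g_xi, hη]
    rw [hX', S.structureTensor_add_left, S.structureTensor_smul_left, ha.2.2.1,
      S.structureTensor_swap, ha.2.2.2, map_add, map_smul, add_apply, smul_apply, hb]
    simp
  rw [S.F_eq_structureTensor hX hξ hφY, h4] at h3
  rw [h1, h2]
  linarith

/-- The `1`-form `η` of a para-Sasaki-like structure is closed. -/
theorem IsParaSasakiLike.eta_mlieBracket [T2Space M] (hS : S.IsParaSasakiLike)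
    {X Y : ∀ p : M, TangentSpace I p} (hX : IsDiffFieldAt I X p) (hY : IsDiffFieldAt I Y p) :
    mvfderiv I (fun q => S.eta q (Y q)) p (X p) - mvfderiv I (fun q => S.eta q (X q)) p (Y p)
      = S.eta p (VectorField.mlieBracket I X Y p) := by
  have h1 := hS.koszul_xi hX hY
  have h2 := hS.koszul_xi hY hX
  have e1 : (fun q => S.g.inner q (S.xi q) (Y q)) = fun q => S.eta q (Y q) :=
    funext fun q => by rw [S.g.symm, S.g_xi]
  have e2 : (fun q => S.g.inner q (S.xi q) (X q)) = fun q => S.eta q (X q) :=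
    funext fun q => by rw [S.g.symm, S.g_xi]
  have e3 : (fun q => S.g.inner q (X q) (Y q)) = fun q => S.g.inner q (Y q) (X q) :=
    funext fun q => S.g.symm q _ _
  have h3 := S.g_phi_comm p (X p) (Y p)
  rw [S.g.symm] at h3
  rw [koszul, e1] at h1
  rw [koszul, e2, e3] at h2
  simp only [S.g_xi, VectorField.mlieBracket_swap_apply (V := Y) (W := X), map_neg, neg_apply,
    VectorField.mlieBracket_swap_apply (V := Y) (W := S.xi),
    VectorField.mlieBracket_swap_apply (V := X) (W := S.xi)] at h1 h2
  linear_combination h1 - h2 - h3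

end ApcpcR

end Closedness

/-! ### The contact form in a chart -/

section ChartForm

theorem mlieBracket_eq_lieBracket {E : Type*} [NormedAddCommGroup E] [NormedSpace ℝ E]
    (V W : ∀ x : E, TangentSpace 𝓘(ℝ, E) x) (x : E) :
    VectorField.mlieBracket 𝓘(ℝ, E) V W x = VectorField.lieBracket ℝ V W x := by
  rw [← VectorField.mlieBracketWithin_univ,
    VectorField.mlieBracketWithin_eq_lieBracketWithin]
  exact congrFun VectorField.lieBracketWithin_univ x

variable {E : Type*} [NormedAddCommGroup E] [NormedSpace ℝ E]
  {H : Type*} [TopologicalSpace H] {I : ModelWithCorners ℝ E H}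
  {M : Type*} [TopologicalSpace M] [ChartedSpace H M] [IsManifold I ∞ M]

theorem contMDiffAt_extChartAt_symm_of_boundaryless [I.Boundaryless] {p : M} {x : E}
    (hx : x ∈ (extChartAt I p).target) :
    ContMDiffAt 𝓘(ℝ, E) I ∞ (extChartAt I p).symm x :=
  (contMDiffOn_extChartAt_symm p).contMDiffAt ((isOpen_extChartAt_target p).mem_nhds hx)

theorem isInvertible_mfderiv_extChartAt_symm [I.Boundaryless] {p : M} {x : E}
    (hx : x ∈ (extChartAt I p).target) :
    (mfderiv 𝓘(ℝ, E) I (extChartAt I p).symm x).IsInvertible := by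
  have h := isInvertible_mfderivWithin_extChartAt_symm hx
  rwa [I.range_eq_univ, mfderivWithin_univ] at h

namespace ApcpcR

variable {n : ℕ} (S : ApcpcR n I M) (p : M)

/-- The `1`-form `η` in the chart at `p`. -/
def chartForm (x : E) : E →L[ℝ] ℝ :=
  (S.eta ((extChartAt I p).symm x)).comp
    (mfderiv 𝓘(ℝ, E) I (extChartAt I p).symm x : E →L[ℝ] TangentSpace I ((extChartAt I p).symm x))

theorem chartForm_apply (x a : E) : S.chartForm p x a
    = S.eta ((extChartAt I p).symm x) (mfderiv 𝓘(ℝ, E) I (extChartAt I p).symm x a) := rfl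

variable [FiniteDimensional ℝ E] [I.Boundaryless]

theorem contDiffOn_chartForm : ContDiffOn ℝ ∞ (S.chartForm p) (extChartAt I p).target := by
  rw [contDiffOn_clm_apply]
  intro a x hx
  have hopen := isOpen_extChartAt_target (I := I) p
  have hsm := contMDiffOn_extChartAt_symm (I := I) (n := ∞) p
  have h1 : ContMDiffOn 𝓘(ℝ, E) I.tangent ∞
      (fun x : E => (⟨(extChartAt I p).symm x,
        mfderiv 𝓘(ℝ, E) I (extChartAt I p).symm x a⟩ : TangentBundle I M))
      (extChartAt I p).target := by
    have h2 := hsm.contMDiffOn_tangentMapWithin (m := ∞) (by simp) hopen.uniqueMDiffOn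
    have h3 : ContMDiff 𝓘(ℝ, E) 𝓘(ℝ, E).tangent ∞
        (fun x : E => (⟨x, a⟩ : TangentBundle 𝓘(ℝ, E) E)) :=
      contMDiff_vectorSpace_iff_contDiff.2 contDiff_const
    refine (h2.comp h3.contMDiffOn (fun x hx => hx)).congr fun y hy => ?_
    simp only [Function.comp, tangentMapWithin]
    rw [mfderivWithin_of_isOpen hopen hy]
  have h4 := (S.smooth_eta.contMDiffAt (x := (extChartAt I p).symm x)).comp_contMDiffWithinAt x
    (hsm x hx)
  have h5 := ContMDiffWithinAt.clm_bundle_apply (F₁ := E) (F₂ := ℝ)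
    (E₂ := fun _ : M => ℝ) h4 (h1 x hx)
  rw [contMDiffWithinAt_totalSpace] at h5
  exact h5.2.contDiffWithinAt

variable {S p}

/-- `dη = 0` in a chart: `IsParaSasakiLike.eta_mlieBracket` for fields with prescribed values, pulled
back to the chart. -/
theorem IsParaSasakiLike.fderiv_chartForm_symm [T2Space M] (hS : S.IsParaSasakiLike) {x : E}
    (hx : x ∈ (extChartAt I p).target) (a b : E) :
    fderiv ℝ (S.chartForm p) x a b = fderiv ℝ (S.chartForm p) x b a := by
  set c := (extChartAt I p).symm with hc
  have hcx := contMDiffAt_extChartAt_symm_of_boundaryless hx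
  have hinv := isInvertible_mfderiv_extChartAt_symm hx
  have hα : DifferentiableAt ℝ (S.chartForm p) x :=
    ((S.contDiffOn_chartForm p).contDiffAt
      ((isOpen_extChartAt_target p).mem_nhds hx)).differentiableAt (by simp)
  -- pull fields on `M` back to the chart
  have pull (X : ∀ q : M, TangentSpace I q) (hX : IsDiffFieldAt I X (c x)) :
      ∃ V : E → E, VectorField.mpullback 𝓘(ℝ, E) I c X = V ∧
        mfderiv 𝓘(ℝ, E) I c x (V x) = X (c x) ∧
        ∀ h, mvfderiv I (fun q => S.eta q (X q)) (c x) (mfderiv 𝓘(ℝ, E) I c x h)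
          = fderiv ℝ (S.chartForm p) x h (V x) + S.chartForm p x (fderiv ℝ V x h) := by
    let V : E → E := VectorField.mpullback 𝓘(ℝ, E) I c X
    have hV : DifferentiableAt ℝ V x := by
      have h1 := MDifferentiableAt.mpullback_vectorField (n := ∞) hX hcx hinv
        (by norm_cast)
      exact ((contMDiff_snd_tangentBundle_modelSpace E 𝓘(ℝ, E)).contMDiffAt.mdifferentiableAt
        one_ne_zero |>.comp x h1).differentiableAt
    have hcV (y : E) (hy : y ∈ (extChartAt I p).target) :
        mfderiv 𝓘(ℝ, E) I c y (V y) = X (c y) :=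
      (isInvertible_mfderiv_extChartAt_symm hy).self_apply_inverse _
    refine ⟨V, rfl, hcV x hx, fun h => ?_⟩
    have hη : MDifferentiableAt I 𝓘(ℝ, ℝ) (fun q => S.eta q (X q)) (c x) := by
      have h1 := mdifferentiableAt_inner S.g hX (S.smooth_xi.isDiffFieldAt (c x))
      simpa only [S.g_xi] using h1
    have h1 := mvfderiv_comp_apply x hη (hcx.mdifferentiableAt (by simp)) h
    have e : (fun q => S.eta q (X q)) ∘ c =ᶠ[nhds x] fun y => S.chartForm p y (V y) := by
      filter_upwards [(isOpen_extChartAt_target p).mem_nhds hx] with y hy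
      rw [S.chartForm_apply, ← hc, hcV y hy]
      rfl
    have h2 := (hα.hasFDerivAt.clm_apply hV.hasFDerivAt).congr_of_eventuallyEq e
    rw [← h1, mvfderiv, mfderiv_eq_fderiv, h2.fderiv]
    exact add_comm _ _
  let X : ∀ q : M, TangentSpace I q := extend E (mfderiv 𝓘(ℝ, E) I c x a)
  let Y : ∀ q : M, TangentSpace I q := extend E (mfderiv 𝓘(ℝ, E) I c x b)
  have hX : IsDiffFieldAt I X (c x) := mdifferentiableAt_extend I E _
  have hY : IsDiffFieldAt I Y (c x) := mdifferentiableAt_extend I E _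
  obtain ⟨V, hV', hVx, hVη⟩ := pull X hX
  obtain ⟨W, hW', hWx, hWη⟩ := pull Y hY
  have : IsManifold I (minSmoothness ℝ 2) M := by
    rw [minSmoothness_of_isRCLikeNormedField]; exact IsManifold.of_le (n := ∞) (by norm_cast)
  have : IsManifold I (minSmoothness ℝ 3) M := by
    rw [minSmoothness_of_isRCLikeNormedField]; exact IsManifold.of_le (n := ∞) (by norm_cast)
  have hbr := VectorField.mpullback_mlieBracket (n := ∞) hX hY hcx
    (by rw [minSmoothness_of_isRCLikeNormedField]; norm_cast)
  rw [hV', hW'] at hbr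
  let L : TangentSpace 𝓘(ℝ, E) x := (fderiv ℝ W x (V x) - fderiv ℝ V x (W x) : E)
  replace hbr := hbr.trans (show _ = L from mlieBracket_eq_lieBracket V W x)
  have hbr' : mfderiv 𝓘(ℝ, E) I c x L = VectorField.mlieBracket I X Y (c x) :=
    ((hinv.self_apply_inverse _).symm.trans
      (congrArg (mfderiv 𝓘(ℝ, E) I c x) hbr)).symm
  have hVa : V x = a := hinv.injective (hVx.trans (extend_apply_self ..))
  have hWb : W x = b := hinv.injective (hWx.trans (extend_apply_self ..))
  have hη := hS.eta_mlieBracket hX hY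
  have h1 := hVη b
  have h2 := hWη a
  rw [hVa] at h1
  rw [hWb] at h2
  have h3 : S.eta (c x) (VectorField.mlieBracket I X Y (c x))
      = S.chartForm p x (fderiv ℝ W x a) - S.chartForm p x (fderiv ℝ V x b) := by
    rw [← hbr']
    change S.chartForm p x (fderiv ℝ W x (V x) - fderiv ℝ V x (W x)) = _
    rw [hVa, hWb, map_sub]
  have h4 : X (c x) = mfderiv 𝓘(ℝ, E) I c x a := extend_apply_self ..
  have h5 : Y (c x) = mfderiv 𝓘(ℝ, E) I c x b := extend_apply_self ..
  rw [h3, h4, h5, h1, h2] at hη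
  linarith

end ApcpcR

end ChartForm

/-! ### Existence of integral submanifolds -/

section LeafExistence

universe v

/-- An open subset of a vector space, as a manifold in a prescribed universe; `e` is the
inclusion. -/
theorem exists_manifold_of_isOpen {F : Type} [NormedAddCommGroup F] [NormedSpace ℝ F]
    [FiniteDimensional ℝ F] {V : Set F} (hV : IsOpen V) (hne : V.Nonempty) :
    ∃ (N : Type v) (_ : TopologicalSpace N) (_ : T2Space N) (_ : SecondCountableTopology N)
      (_ : ChartedSpace F N) (_ : IsManifold 𝓘(ℝ, F) ∞ N) (e : N → F),
      ContMDiff 𝓘(ℝ, F) 𝓘(ℝ, F) ∞ e ∧ range e = V ∧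
        ∀ x, Function.Bijective (mfderiv 𝓘(ℝ, F) 𝓘(ℝ, F) e x) := by
  have : ProperSpace F := FiniteDimensional.proper_real F
  have : Nonempty V := hne.to_subtype
  let e : ULift.{v} V → F := fun x => x.down.1
  have he : Topology.IsOpenEmbedding e :=
    hV.isOpenEmbedding_subtypeVal.comp Homeomorph.ulift.isOpenEmbedding
  let _ := he.singletonChartedSpace
  have hr : range e = V := by
    ext y
    exact ⟨by rintro ⟨x, rfl⟩; exact x.down.2, fun hy => ⟨⟨⟨y, hy⟩⟩, rfl⟩⟩
  have hsm : ContMDiff 𝓘(ℝ, F) 𝓘(ℝ, F) ∞ e := contMDiff_isOpenEmbedding he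
  refine ⟨ULift.{v} V, inferInstance, inferInstance, he.isEmbedding.secondCountableTopology,
    he.singletonChartedSpace, he.isManifold_singleton, e, hsm, hr, fun x => ?_⟩
  set e' := (he.toOpenPartialHomeomorph e).symm
  have hsm' : ContMDiffAt 𝓘(ℝ, F) 𝓘(ℝ, F) ∞ e' (e x) :=
    (contMDiffOn_isOpenEmbedding_symm he).contMDiffAt (he.isOpen_range.mem_nhds ⟨x, rfl⟩)
  have hl : ∀ y, e' (e y) = y := fun y => he.toOpenPartialHomeomorph_left_inv
  have hd : MDifferentiableAt 𝓘(ℝ, F) 𝓘(ℝ, F) e x := (hsm x).mdifferentiableAt (by simp)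
  have hd' : MDifferentiableAt 𝓘(ℝ, F) 𝓘(ℝ, F) e' (e x) := hsm'.mdifferentiableAt (by simp)
  have hinj : Function.Injective (mfderiv 𝓘(ℝ, F) 𝓘(ℝ, F) e x) := by
    have h1 := mfderiv_comp x hd' hd
    rw [show e' ∘ e = id from funext hl, mfderiv_id] at h1
    intro a b hab
    have ha := congrArg (fun T => T a) h1
    have hb := congrArg (fun T => T b) h1
    exact ha.trans ((congrArg (mfderiv 𝓘(ℝ, F) 𝓘(ℝ, F) e' (e x)) hab).trans hb.symm)
  let T : F →ₗ[ℝ] F := (mfderiv 𝓘(ℝ, F) 𝓘(ℝ, F) e x : F →L[ℝ] F).toLinearMap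
  exact ⟨hinj, (LinearMap.injective_iff_surjective (f := T)).1 hinj⟩

namespace ApcpcR

variable {E : Type*} [NormedAddCommGroup E] [NormedSpace ℝ E] [FiniteDimensional ℝ E]
  {H : Type*} [TopologicalSpace H] {I : ModelWithCorners ℝ E H}
  {M : Type*} [TopologicalSpace M] [ChartedSpace H M] [IsManifold I ∞ M]
  {E' : Type*} [NormedAddCommGroup E'] [NormedSpace ℝ E'] [FiniteDimensional ℝ E']
  {H' : Type*} [TopologicalSpace H'] {J : ModelWithCorners ℝ E' H'}
  {N : Type*} [TopologicalSpace N] [ChartedSpace H' N]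
  {n : ℕ} {S : ApcpcR n I M}

/-- An immersion tangent to `ker η` is an integral submanifold: `φ` preserves `ker η`, hence
restricts to the tangent spaces. -/
theorem exists_isLeaf_of_range_eq {i : N → M} (hi : ContMDiff J I ∞ i)
    (hinj : ∀ x : N, Function.Injective (mfderiv J I i x))
    (hrange : ∀ (x : N) (y : TangentSpace I (i x)),
      S.eta (i x) y = 0 ↔ ∃ X : TangentSpace J x, mfderiv J I i x X = y) :
    ∃ P, S.IsLeaf J i P := by
  have key (x : N) : ∃ P : TangentSpace J x →L[ℝ] TangentSpace J x,
      ∀ X, mfderiv J I i x (P X) = S.phi (i x) (mfderiv J I i x X) := by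
    have : FiniteDimensional ℝ (TangentSpace J x) := inferInstanceAs (FiniteDimensional ℝ E')
    have : T2Space (TangentSpace J x) := inferInstanceAs (T2Space E')
    let T : TangentSpace J x →ₗ[ℝ] TangentSpace I (i x) := (mfderiv J I i x).toLinearMap
    let R : TangentSpace J x →ₗ[ℝ] LinearMap.range T :=
      ((S.phi (i x)).toLinearMap ∘ₗ T).codRestrict _ fun X =>
        (hrange x _).1 (S.eta_phi (i x) _)
    let L := (LinearEquiv.ofInjective T (hinj x)).symm.toLinearMap ∘ₗ R
    refine ⟨LinearMap.toContinuousLinearMap L, fun X => ?_⟩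
    exact congrArg Subtype.val ((LinearEquiv.ofInjective T (hinj x)).apply_symm_apply (R X))
  choose P hP using key
  exact ⟨P, hi, hinj, hrange, hP⟩

/-- The distribution `ker η` of a para-Sasaki-like structure is integrable: an integral submanifold
passes through every point. -/
theorem IsParaSasakiLike.exists_isLeaf [T2Space M] [I.Boundaryless] (hS : S.IsParaSasakiLike)
    {F : Type} [NormedAddCommGroup F] [NormedSpace ℝ F] [FiniteDimensional ℝ F]
    (hdim : finrank ℝ E = finrank ℝ F + 1) (p : M) :
    ∃ (N : Type v) (_ : TopologicalSpace N) (_ : T2Space N) (_ : SecondCountableTopology N)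
      (_ : ChartedSpace F N) (_ : IsManifold 𝓘(ℝ, F) ∞ N) (i : N → M)
      (P : ∀ x : N, TangentSpace 𝓘(ℝ, F) x →L[ℝ] TangentSpace 𝓘(ℝ, F) x) (x : N),
      i x = p ∧ S.IsLeaf 𝓘(ℝ, F) i P := by
  set c := (extChartAt I p).symm with hc
  have h0 : S.chartForm p (extChartAt I p p) ≠ 0 := by
    intro h
    obtain ⟨a, ha⟩ := (isInvertible_mfderiv_extChartAt_symm
      (mem_extChartAt_target (I := I) p)).surjective (S.xi _)
    have h1 := congrArg (fun T => T a) h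
    have h2 := S.chartForm_apply p (extChartAt I p p) a
    rw [ha, S.eta_xi] at h2
    exact one_ne_zero (h2.symm.trans h1)
  obtain ⟨V, y₀, j, hV, hy₀, hj₀, hj, hjV⟩ := exists_integral_parametrization hdim
    (isOpen_extChartAt_target p) (mem_extChartAt_target (I := I) p) (S.contDiffOn_chartForm p)
    (fun x hx => hS.fderiv_chartForm_symm hx) h0
  obtain ⟨N, _, _, _, _, _, e, he, hr, hbij⟩ := exists_manifold_of_isOpen.{v} hV ⟨y₀, hy₀⟩
  have heV (x : N) : e x ∈ V := hr ▸ mem_range_self x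
  have hjx (x : N) : ContMDiffAt 𝓘(ℝ, F) 𝓘(ℝ, E) ∞ j (e x) :=
    (hj.contDiffAt (hV.mem_nhds (heV x))).contMDiffAt
  have hcx (x : N) := contMDiffAt_extChartAt_symm_of_boundaryless (hjV _ (heV x)).1
  have hdc (x : N) : mfderiv 𝓘(ℝ, F) I (c ∘ j ∘ e) x
      = (mfderiv 𝓘(ℝ, E) I c (j (e x))).comp ((mfderiv 𝓘(ℝ, F) 𝓘(ℝ, E) j (e x)).comp
        (mfderiv 𝓘(ℝ, F) 𝓘(ℝ, F) e x)) := by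
    have hje := ((hjx x).mdifferentiableAt (by simp)).comp x ((he x).mdifferentiableAt (by simp))
    rw [mfderiv_comp x ((hcx x).mdifferentiableAt (by simp)) hje,
      mfderiv_comp x ((hjx x).mdifferentiableAt (by simp)) ((he x).mdifferentiableAt (by simp))]
    rfl
  have hinv (x : N) := isInvertible_mfderiv_extChartAt_symm (hjV _ (heV x)).1
  have hi : ContMDiff 𝓘(ℝ, F) I ∞ (c ∘ j ∘ e) := fun x => (hcx x).comp x ((hjx x).comp x (he x))
  have hinj (x : N) : Function.Injective (mfderiv 𝓘(ℝ, F) I (c ∘ j ∘ e) x) := by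
    rw [hdc]
    have hjinj := (hjV _ (heV x)).2.1
    rw [← mfderiv_eq_fderiv] at hjinj
    exact (hinv x).injective.comp (hjinj.comp (hbij x).1)
  have hrange (x : N) (y : TangentSpace I ((c ∘ j ∘ e) x)) :
      S.eta ((c ∘ j ∘ e) x) y = 0 ↔
        ∃ X : TangentSpace 𝓘(ℝ, F) x, mfderiv 𝓘(ℝ, F) I (c ∘ j ∘ e) x X = y := by
    obtain ⟨a, rfl⟩ := (hinv x).surjective y
    refine ((hjV _ (heV x)).2.2 a).trans ?_
    rw [hdc]
    constructor
    · rintro ⟨b, hb⟩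
      obtain ⟨X, hX⟩ := (hbij x).2 b
      rw [← mfderiv_eq_fderiv] at hb
      exact ⟨X, congrArg (mfderiv 𝓘(ℝ, E) I c (j (e x)))
        ((congrArg (mfderiv 𝓘(ℝ, F) 𝓘(ℝ, E) j (e x)) hX).trans hb)⟩
    · rintro ⟨X, hX⟩
      refine ⟨mfderiv 𝓘(ℝ, F) 𝓘(ℝ, F) e x X, ?_⟩
      rw [← mfderiv_eq_fderiv]
      exact (hinv x).injective hX
  obtain ⟨P, hP⟩ := exists_isLeaf_of_range_eq hi hinj hrange
  obtain ⟨x, hx⟩ : y₀ ∈ range e := hr ▸ hy₀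
  refine ⟨N, _, ‹_›, ‹_›, _, ‹_›, c ∘ j ∘ e, P, x, ?_, hP⟩
  change c (j (e x)) = p
  rw [hx, hj₀]
  exact extChartAt_to_inv p

end ApcpcR

end LeafExistence

end ParacontactGeometry

end

open ParacontactGeometry in
theorem proposition4p2 {n : ℕ} (hn : 1 ≤ n) {M : Type u} [TopologicalSpace M] [T2Space M]
    [SecondCountableTopology M] [ChartedSpace (EuclideanSpace ℝ (Fin (2 * n + 1))) M]
    [IsManifold (𝓡 (2 * n + 1)) ∞ M]
    (S : ApcpcR n (𝓡 (2 * n + 1)) M) (hS : S.IsParaSasakiLike)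
    (u v w : C^∞⟮𝓡 (2 * n + 1), M; ℝ⟯) :
    -- the characterization
    ((S.conformal u v w).IsParaSasakiLike ↔
      ∀ p : M,
        (mvfderiv (𝓡 (2 * n + 1)) w p).comp (S.phi p) = 0 ∧
        mvfderiv (𝓡 (2 * n + 1)) u p - (mvfderiv (𝓡 (2 * n + 1)) v p).comp (S.phi p) = 0 ∧
        (mvfderiv (𝓡 (2 * n + 1)) u p).comp (S.phi p) - mvfderiv (𝓡 (2 * n + 1)) v p
          = (1 - Real.exp (w p)) • S.eta p) ∧
    -- the derivatives in the direction of `ξ`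
    ((S.conformal u v w).IsParaSasakiLike →
      ∀ p : M, mvfderiv (𝓡 (2 * n + 1)) u p (S.xi p) = 0 ∧
        mvfderiv (𝓡 (2 * n + 1)) v p (S.xi p) = Real.exp (w p) - 1) ∧
    -- the case `w = 0`
    ((∀ p : M, w p = 0) →
      -- para-Sasaki-like iff `u`, `v` do not depend on `ξ` and `u + e v` is paraholomorphic on
      -- every integral submanifold `N` of `H`
      ((S.conformal u v w).IsParaSasakiLike ↔
        (∀ p : M, mvfderiv (𝓡 (2 * n + 1)) u p (S.xi p) = 0 ∧
          mvfderiv (𝓡 (2 * n + 1)) v p (S.xi p) = 0) ∧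
        ∀ (N : Type u) [TopologicalSpace N] [T2Space N] [SecondCountableTopology N]
          [ChartedSpace (EuclideanSpace ℝ (Fin (2 * n))) N] [IsManifold (𝓡 (2 * n)) ∞ N]
          (i : N → M) (P : ∀ x : N, TangentSpace (𝓡 (2 * n)) x →L[ℝ] TangentSpace (𝓡 (2 * n)) x),
          S.IsLeaf (𝓡 (2 * n)) i P →
            IsParaholomorphic (𝓡 (2 * n)) P (paraFun (fun x => u (i x)) (fun x => v (i x)))) ∧
      -- in a local splitting, `u` and `v` are pulled back from `N`
      ((S.conformal u v w).IsParaSasakiLike →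
        ∀ (N : Type u) [TopologicalSpace N] [T2Space N] [SecondCountableTopology N]
          [ChartedSpace (EuclideanSpace ℝ (Fin (2 * n))) N] [IsManifold (𝓡 (2 * n)) ∞ N]
          (a b : ℝ) (Φ : ℝ × N → M)
          (P : ∀ x : N, TangentSpace (𝓡 (2 * n)) x →L[ℝ] TangentSpace (𝓡 (2 * n)) x),
          S.IsSplitting (𝓡 (2 * n)) a b Φ P →
            ∃ uN vN : N → ℝ,
              (∀ t ∈ Set.Ioo a b, ∀ x : N, u (Φ (t, x)) = uN x ∧ v (Φ (t, x)) = vN x) ∧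
              IsParaholomorphic (𝓡 (2 * n)) P (paraFun uN vN))) := by
  refine ⟨hS.conformal_iff_mvfderiv hn u v w, fun h p => ?_, fun hw => ⟨?_, fun h => ?_⟩⟩
  · have h1 := ((hS.conformal_iff u v w hn).1 h p 1 (by norm_num)).2.2
    have h2 := ((hS.conformal_iff u v w hn).1 h p (-1) (by norm_num)).2.2
    constructor <;> linarith
  · rw [hS.conformal_iff_of_eq_zero hn u v hw]
    refine and_congr_right fun _ => ⟨fun h N _ _ _ _ _ i P hi => ?_, fun h p => ?_⟩
    · exact (hi.isParaholomorphic_iff u v).2 fun x => h (i x)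
    · obtain ⟨N, _, _, _, _, _, i, P, x, rfl, hi⟩ := hS.exists_isLeaf.{u}
        (F := EuclideanSpace ℝ (Fin (2 * n))) (by simp) p
      exact (hi.isParaholomorphic_iff u v).1 (h N i P hi) x
  · obtain ⟨hξ, hφ⟩ := (hS.conformal_iff_of_eq_zero hn u v hw).1 h
    intro N _ _ _ _ _ a b Φ P hΦ
    -- the slice at the midpoint serves to define `u_N` and `v_N`
    have hm : (a + b) / 2 ∈ Set.Ioo a b := ⟨by linarith [hΦ.lt], by linarith [hΦ.lt]⟩
    exact ⟨fun x => u (Φ ((a + b) / 2, x)), fun x => v (Φ ((a + b) / 2, x)),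
      fun t ht x => ⟨hΦ.apply_eq_apply (fun p => (hξ p).1) ht hm x,
        hΦ.apply_eq_apply (fun p => (hξ p).2) ht hm x⟩,
      ((hΦ.leaf _ hm).isParaholomorphic_iff u v).2 fun x => hφ _⟩
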